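/- Let $\mathbb{T}^2=(\mathbb{R}/2\pi\mathbb{Z})^2$ and $\tau\in(0,1]$. For $f\in L^2(\mathbb{T}^2)$ and $k\in\mathbb{Z}^2$ put $\widehat f(k)=\frac1{4\pi^2}\int_{\mathbb{T}^2}f(x)e^{-i\langle k,x\rangle}\,dx$ and define the frequency filter $$\Pi_\tau f(x)=\sum_{k\in\mathbb{Z}^2,\ |k_1|,|k_2|\le\tau^{-1/2}}\widehat f(k)\,e^{i\langle k,x\rangle}.$$ For a sequence $u=(u_n)_{n\in\mathbb{Z}}$ of functions in $L^2(\mathbb{T}^2)$ with $\sum_m|\widehat{u_m}(k)|^2<\infty$ for every $k$, let $$\widetilde u(\sigma,k)=\tau\sum_{m\in\mathbb{Z}}\widehat{u_m}(k)e^{im\tau\sigma}$$ (convergence in $L^2$ over a period in $\sigma$). For $s\ge 0$ and $b\in\mathbb{R}$ let $X^{s,b}_\tau$ be the space of those $u$ for which $$\|u_n\|_{X^{s,b}_\tau}=\Big(\sum_{k\in\mathbb{Z}^2}\int_{-\pi/\tau}^{\pi/\tau}\langle k\rangle^{2s}\,\langle d_\tau(\sigma-|k|^2)\rangle^{2b}\,|\widetilde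 u(\sigma,k)|^2\,d\sigma\Big)^{1/2}<\infty,\qquad d_\tau(\sigma)=\frac{e^{i\tau\sigma}-1}{\tau},\quad \langle\cdot\rangle=(1+|\cdot|^2)^{1/2},$$ and let $\|u_n\|_{l^4_\tau L^4}=\big(\tau\sum_{n\in\mathbb{Z}}\|u_n\|_{L^4(\mathbb{T}^2)}^4\big)^{1/4}$. **Theorem 3.3.** Let $s>0$, $b>\max(\frac14,\frac12-\frac s4)$ and $b_1>\frac12$. There are constants, depending only on $s$ and $b_1$ in (i) and only on $s$ and $b$ in (ii) and (iii), and in particular independent of $\tau\in(0,1]$ and of the sequences, such that the following estimates $\lesssim$ hold. (i) For every $u\in X^{s,b_1}_\tau$, $$\|\Pi_\tau u_n\|_{l^4_\tau L^4}\lesssim\|u_n\|_{X^{s,b_1}_\tau}.$$ (ii) For all $u_1,u_2,u_3\in X^{s,b}_\tau$, the sequence $\Pi_\tau(\Pi_\tau u_{n,1}\,\overline{\Pi_\tau u_{n,2}}\,\Pi_\tau u_{n,3})$ belongs to $X^{s,-b}_\tau$ and $$\|\Pi_\tau(\Pi_\tau u_{n,1}\,\overline{\Pi_\tau u_{n,2}}\,\Pi_\tau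 u_{n,3})\|_{X^{s,-b}_\tau}\lesssim\|u_{n,1}\|_{X^{s,b}_\tau}\|u_{n,2}\|_{X^{s,b}_\tau}\|u_{n,3}\|_{X^{s,b}_\tau}.$$ (iii) For every permutation $\rho$ of $\{1,2,3\}$ and all $u_1,u_2,u_3$ with $u_{\rho(1)},u_{\rho(2)}\in X^{s,b}_\tau$ and $u_{\rho(3)}\in X^{0,b}_\tau$, the sequence $\Pi_\tau(\Pi_\tau u_{n,1}\,\overline{\Pi_\tau u_{n,2}}\,\Pi_\tau u_{n,3})$ belongs to $X^{0,-b}_\tau$ and $$\|\Pi_\tau(\Pi_\tau u_{n,1}\,\overline{\Pi_\tau u_{n,2}}\,\Pi_\tau u_{n,3})\|_{X^{0,-b}_\tau}\lesssim\|u_{n,\rho(1)}\|_{X^{s,b}_\tau}\|u_{n,\rho(2)}\|_{X^{s,b}_\tau}\|u_{n,\rho(3)}\|_{X^{0,b}_\tau}.$$ -/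

import Mathlib

open MeasureTheory
open scoped Real NNReal ENNReal

noncomputable section

namespace DiscreteBourgain

instance factTwoPi : Fact (0 < 2 * π) := ⟨Real.two_pi_pos⟩

/-- The two-dimensional torus `(ℝ / 2πℤ)²`; its `volume` is Lebesgue measure, of total mass `4π²`. -/
abbrev Torus : Type := Fin 2 → AddCircle (2 * π)

/-- Space frequencies `k ∈ ℤ²`. -/
abbrev Freq : Type := Fin 2 → ℤ

/-- `|k|² = k₁² + k₂²`. -/
def freqSq (k : Freq) : ℝ := ∑ i, (k i : ℝ) ^ 2

/-- The character `x ↦ exp(i⟨k, x⟩)` of the torus. -/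
def character (k : Freq) (x : Torus) : ℂ := ∏ i, fourier (k i) (x i)

/-- The Fourier coefficient `(4π²)⁻¹ ∫ f(x) exp(-i⟨k, x⟩) dx`. -/
def coeff (f : Torus → ℂ) (k : Freq) : ℂ :=
  (1 / (4 * (π : ℂ) ^ 2)) * ∫ x, f x * (starRingEnd ℂ) (character k x)

/-- The frequencies `k ∈ ℤ²` with `k / τ^(-1/2) ∈ [-1,1]²` (see `mem_lowFreq`). -/
def lowFreq (τ : ℝ) : Finset Freq :=
  Fintype.piFinset fun _ => Finset.Icc (-⌊τ ^ (-(1 / 2) : ℝ)⌋) ⌊τ ^ (-(1 / 2) : ℝ)⌋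

theorem mem_lowFreq (τ : ℝ) (k : Freq) :
    k ∈ lowFreq τ ↔ ∀ i, |(k i : ℝ)| ≤ τ ^ (-(1 / 2) : ℝ) := by
  simp only [lowFreq, Fintype.mem_piFinset, Finset.mem_Icc]
  refine forall_congr' fun i => ?_
  rw [abs_le, Int.le_floor, neg_le, Int.le_floor, Int.cast_neg, neg_le]

/-- The frequency filter `Π_τ`, i.e. the Fourier multiplier `χ(-i∂ₓ / τ^(-1/2))` where `χ` is the
characteristic function of `[-1,1]²`. -/
def filterProj (τ : ℝ) (f : Torus → ℂ) (x : Torus) : ℂ :=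
  ∑ k ∈ lowFreq τ, coeff f k * character k x

/-- `⟨k⟩ = (1 + |k|²)^(1/2)`. -/
def spaceBracket (k : Freq) : ℝ := √(1 + freqSq k)

/-- `⟨z⟩ = (1 + |z|²)^(1/2)` for complex `z`. -/
def bracket (z : ℂ) : ℝ := √(1 + ‖z‖ ^ 2)

/-- `d_τ(σ) = (exp(iτσ) - 1) / τ`. -/
def dTau (τ σ : ℝ) : ℂ := (Complex.exp (Complex.I * τ * σ) - 1) / τ

instance factPeriod (τ : ℝ) [hτ : Fact (0 < τ)] : Fact (0 < 2 * π / τ) :=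
  ⟨div_pos Real.two_pi_pos hτ.out⟩

/-- The discrete time Fourier transform `σ ↦ τ ∑ₘ c(m) exp(imτσ)` of a square summable sequence:
the series converges in `L²` over one period `2π / τ` (on `AddCircle (2 * π / τ)` the monomial
`fourier m` is `σ ↦ exp(imτσ)`). -/
def timeFT (τ : ℝ) [Fact (0 < τ)] (c : ℤ → ℂ) :
    Lp ℂ 2 (AddCircle.haarAddCircle (T := 2 * π / τ)) :=
  ∑' m : ℤ, ((τ : ℂ) * c m) • fourierLp 2 m

/-- The space-time Fourier transform `ũ(σ, k) = τ ∑ₘ ûₘ(k) exp(imτσ)`. -/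
def spaceTimeFT (τ : ℝ) [Fact (0 < τ)] (u : ℤ → Torus → ℂ) (σ : ℝ) (k : Freq) : ℂ :=
  timeFT τ (fun m => coeff (u m) k) (σ : AddCircle (2 * π / τ))

/-- The norm of the discrete Bourgain space `X^{s,b}_τ`, i.e. the `L²` norm in
`σ ∈ (-π/τ, π/τ]` and `ℓ²` norm in `k ∈ ℤ²` of `⟨k⟩^s ⟨d_τ(σ - |k|²)⟩^b ũ(σ, k)`. -/
def XNorm (τ : ℝ) [Fact (0 < τ)] (s b : ℝ) (u : ℤ → Torus → ℂ) : ℝ≥0∞ :=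
  (∑' k : Freq, ∫⁻ σ in Set.Ioc (-π / τ) (π / τ),
    ‖((spaceBracket k ^ s * bracket (dTau τ (σ - freqSq k)) ^ b : ℝ) : ℂ)
      * spaceTimeFT τ u σ k‖ₑ ^ 2) ^ (1 / 2 : ℝ)

/-- Membership in the discrete Bourgain space `X^{s,b}_τ`, for `s ≥ 0`: a sequence of `L²`
functions on the torus for which the space-time Fourier transform makes sense (the Fourier
coefficients of each frequency are square summable in time) and the norm is finite. -/
structure MemX (τ : ℝ) [Fact (0 < τ)] (s b : ℝ) (u : ℤ → Torus → ℂ) : Prop where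
  memLp : ∀ n, MemLp (u n) 2
  summable : ∀ k, Summable fun n => ‖coeff (u n) k‖ ^ 2
  norm_lt_top : XNorm τ s b u < ∞

/-- The norm of `ℓ^p_τ L^p`, namely `(τ ∑ₙ ‖uₙ‖_{L^p}^p)^(1/p)`, for `0 < p < ∞`. -/
def seqLpNorm (τ : ℝ) (p : ℝ) (u : ℤ → Torus → ℂ) : ℝ≥0∞ :=
  (ENNReal.ofReal τ * ∑' n : ℤ, eLpNorm (u n) (ENNReal.ofReal p) volume ^ p) ^ (1 / p)

/-- The filtered cubic product `Π_τ(Π_τ u₁ · conj(Π_τ u₂) · Π_τ u₃)`, taken at each time `n`. -/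
def cubic (τ : ℝ) (u₁ u₂ u₃ : ℤ → Torus → ℂ) (n : ℤ) : Torus → ℂ :=
  filterProj τ fun x =>
    filterProj τ (u₁ n) x * (starRingEnd ℂ) (filterProj τ (u₂ n) x) * filterProj τ (u₃ n) x

end DiscreteBourgain

end

/-! The convolution theorem turns products into convolutions, so everything is bounded by
convolutions of nonnegative functions on phase space `ℤ² × ℝ/(2π/τ)ℤ`: the moduli of the space-time
Fourier transforms, cut to the filtered frequencies. There a single bilinear estimate,
`exists_l2_lconvolution_le`, carries all three claims: `f ⋆ g` is controlled in `L²` with the weight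
of `X^{s,b}` on `f` and only that of `X^{0,b}` on `g`.

Cauchy–Schwarz under the convolution reduces it to a bound, uniform in `(k, σ)`, for a sum over `j`
of `⟨j⟩^{-2s}` times a time integral, and the latter is `O((1 + |σ - |j|² - |k-j|²|)^{-β})` with
distances modulo `2π/τ`. For `β > 1` any negative power of `⟨j⟩` suffices
(`exists_sum_resonance_le`): `|j|² + |k-j|² = m` puts `2j - k` on a circle of squared radius `n`,
which carries `O(n^ε)` Gaussian integers, and at most two such `j` have `⟨j⟩` below a small multiple
of `n^{1/6}`, since a lattice triangle inscribed in a large circle has a long side. The weight of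
the other points absorbs the divisor loss, uniformly in `k`. For `β = 0` one needs `s > 1`.
Interpolation gives the range `β > 1 - s`, while the time integral requires `β < 4b - 1`; this is
where `b > 1/2 - s/4` comes from. The filter keeps `|j|² + |k-j|²` below one period, so its values
do not alias and the constants do not depend on `τ`.

Claim (i) is the bilinear estimate for the square of the filtered function. For (ii) and (iii) the
cubic term is paired with a test function and split by Cauchy–Schwarz into two bilinear terms.
Reflecting a factor does not change the `L²` norm of a convolution of nonnegative functions, so
conjugates cost nothing and the factors can be grouped as needed. In (ii) the weight `⟨k⟩^s` is
first moved onto one of the three factors. -/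

noncomputable section

namespace DiscreteBourgain

/-! ### Gaussian integers of given norm, and lattice points on circles -/

section Counting

open GaussianInt Zsqrtd

theorem finite_gaussianInt_norm_eq (n : ℤ) : {z : GaussianInt | z.norm = n}.Finite := by
  refine Set.Finite.subset
    (((Set.finite_Icc (-n) n).prod (Set.finite_Icc (-n) n)).image fun p => (⟨p.1, p.2⟩ : GaussianInt)) ?_
  rintro ⟨x, y⟩ h
  simp only [Set.mem_ofPred_eq, Zsqrtd.norm_def] at h
  refine ⟨(x, y), ⟨⟨?_, ?_⟩, ⟨?_, ?_⟩⟩, rfl⟩ <;> dsimp only <;>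
    nlinarith [Int.le_self_sq x, Int.le_self_sq (-x), Int.le_self_sq y, Int.le_self_sq (-y)]

/-- Recording only that the norm of `ϖ` is a positive power of `p` treats split, inert and ramified
primes alike. -/
theorem exists_gaussianPrime_dvd (p : ℕ) (hp : p.Prime) :
    ∃ ϖ : GaussianInt, Prime ϖ ∧ ϖ ∣ (p : GaussianInt) ∧ ∃ e : ℕ, 0 < e ∧ ϖ.norm = (p : ℤ) ^ e := by
  have hnu : ¬ IsUnit (p : GaussianInt) := by
    intro h
    have h2 := Zsqrtd.norm_eq_one_iff.2 h
    have : (Zsqrtd.norm (p : GaussianInt)) = (p : ℤ) * p := Zsqrtd.norm_natCast p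
    rw [this, Int.natAbs_mul, Int.natAbs_natCast] at h2
    exact hp.one_lt.ne' (Nat.eq_one_of_mul_eq_one_left h2)
  have h0 : (p : GaussianInt) ≠ 0 := by exact_mod_cast hp.ne_zero
  obtain ⟨q, hq, hd⟩ := WfDvdMonoid.exists_irreducible_factor hnu h0
  refine ⟨q, hq.prime, hd, ?_⟩
  obtain ⟨w, hw⟩ := hd
  have h1 : q.norm.natAbs ∣ p ^ 2 := by
    have : Zsqrtd.norm (p : GaussianInt) = q.norm * w.norm := by rw [hw, Zsqrtd.norm_mul]
    rw [Zsqrtd.norm_natCast] at this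
    refine ⟨w.norm.natAbs, ?_⟩
    rw [← Int.natAbs_mul, ← this, Int.natAbs_mul, Int.natAbs_natCast, sq]
  obtain ⟨e, -, he⟩ := (Nat.dvd_prime_pow hp).1 h1
  refine ⟨e, ?_, ?_⟩
  · rcases Nat.eq_zero_or_pos e with rfl | h
    · exact absurd (Zsqrtd.norm_eq_one_iff.1 (by simpa using he)) hq.not_isUnit
    · exact h
  · rw [← GaussianInt.abs_natCast_norm q, he]; push_cast; rfl

/-- Induction on `a`: `ϖ` divides `p`, hence `z * star z`, so it divides `z` or `star z`; in the
second case `star ϖ` divides `z`. Cancelling it lowers the exponent of `p` by `e`. -/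
theorem exists_factor_of_norm_eq {p : ℕ} (hp : p.Prime) {ϖ : GaussianInt} (hϖ : Prime ϖ)
    (hd : ϖ ∣ (p : GaussianInt)) {e : ℕ} (hϖn : ϖ.norm = (p : ℤ) ^ e) {m : ℕ}
    (hm : ¬ p ∣ m) (a : ℕ) :
    ∀ z : GaussianInt, z.norm = (p : ℤ) ^ a * m →
      ∃ (i j : ℕ) (w : GaussianInt), z = ϖ ^ i * star ϖ ^ j * w ∧ w.norm = m := by
  have hp0 : (p : ℤ) ≠ 0 := by exact_mod_cast hp.ne_zero
  have he : 0 < e := by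
    rcases Nat.eq_zero_or_pos e with rfl | h
    · refine absurd (Zsqrtd.norm_eq_one_iff.1 ?_) hϖ.not_isUnit
      rw [hϖn]; simp
    · exact h
  induction a using Nat.strong_induction_on with
  | _ a ih =>
    intro z hz
    rcases Nat.eq_zero_or_pos a with rfl | ha
    · exact ⟨0, 0, z, by simp, by simpa using hz⟩
    have key : ∀ w v : GaussianInt, v.norm = (p : ℤ) ^ e → z = v * w →
        w.norm = (p : ℤ) ^ (a - e) * m ∧ a - e < a := by
      intro w v hv hzw
      have h1 : (p : ℤ) ^ e * w.norm = (p : ℤ) ^ a * m := by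
        rw [← hz, hzw, Zsqrtd.norm_mul, hv]
      refine ⟨?_, by omega⟩
      have hea : e ≤ a := by
        by_contra hlt
        push Not at hlt
        obtain ⟨t, rfl⟩ := Nat.exists_eq_add_of_lt hlt
        have h2 : (p : ℤ) ^ a * ((p : ℤ) * ((p : ℤ) ^ t * w.norm)) = (p : ℤ) ^ a * m := by
          rw [← h1]; ring
        have h3 := mul_left_cancel₀ (pow_ne_zero a hp0) h2
        exact hm (Int.natCast_dvd_natCast.1 ⟨_, h3.symm⟩)
      obtain ⟨t, rfl⟩ := Nat.exists_eq_add_of_le hea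
      refine mul_left_cancel₀ (pow_ne_zero e hp0) ?_
      rw [h1, Nat.add_sub_cancel_left]; ring
    have hdz : ϖ ∣ z * star z := by
      rw [← Zsqrtd.norm_eq_mul_conj, hz]
      obtain ⟨t, ht⟩ := hd
      obtain ⟨b, rfl⟩ := Nat.exists_eq_succ_of_ne_zero ha.ne'
      refine ⟨t * ((p : GaussianInt) ^ b * m), ?_⟩
      push_cast
      rw [← mul_assoc, ← ht, Nat.succ_eq_add_one, pow_succ]; ring
    rcases hϖ.dvd_or_dvd hdz with ⟨w, hw⟩ | ⟨w, hw⟩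
    · obtain ⟨h1, h2⟩ := key w ϖ hϖn hw
      obtain ⟨i, j, v, hv, hvm⟩ := ih _ h2 w h1
      exact ⟨i + 1, j, v, by rw [hw, hv]; ring, hvm⟩
    · have hw' : z = star ϖ * star w := by
        rw [← star_star z, hw, star_mul, mul_comm]
      obtain ⟨h1, h2⟩ := key (star w) (star ϖ) (by rw [Zsqrtd.norm_conj, hϖn]) hw'
      obtain ⟨i, j, v, hv, hvm⟩ := ih _ h2 _ h1
      exact ⟨i, j + 1, v, by rw [hw', hv]; ring, hvm⟩

/-- In `z = ϖ ^ i * star ϖ ^ j * w` the norm forces `e * (i + j) = a`, so `i` determines `j` and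
takes at most `a + 1` values for each `w`. -/
theorem ncard_norm_prime_pow_mul_le {p : ℕ} (hp : p.Prime) {m : ℕ} (hm : ¬ p ∣ m) (a : ℕ) :
    {z : GaussianInt | z.norm = ((p ^ a * m : ℕ) : ℤ)}.ncard ≤
      (a + 1) * {z : GaussianInt | z.norm = (m : ℤ)}.ncard := by
  obtain ⟨ϖ, hϖ, hd, e, he, hϖn⟩ := exists_gaussianPrime_dvd p hp
  have hm0 : m ≠ 0 := by rintro rfl; exact hm (dvd_zero _)
  set S := {z : GaussianInt | z.norm = (m : ℤ)} with hS
  have hSf : S.Finite := finite_gaussianInt_norm_eq m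
  let F : ℕ × GaussianInt → GaussianInt := fun q => ϖ ^ q.1 * star ϖ ^ (a / e - q.1) * q.2
  have hfin : ((Finset.range (a + 1) : Set ℕ) ×ˢ S).Finite := (Finset.finite_toSet _).prod hSf
  have hsub : {z : GaussianInt | z.norm = ((p ^ a * m : ℕ) : ℤ)} ⊆
      F '' ((Finset.range (a + 1) : Set ℕ) ×ˢ S) := by
    intro z hz
    have hz' : z.norm = (p : ℤ) ^ a * m := by simpa using hz
    obtain ⟨i, j, w, hw, hwm⟩ := exists_factor_of_norm_eq hp hϖ hd hϖn hm a z hz'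
    have hij : e * (i + j) = a := by
      have h1 : ((p : ℤ) ^ e) ^ i * ((p : ℤ) ^ e) ^ j * m = (p : ℤ) ^ a * m := by
        rw [← hz', hw, Zsqrtd.norm_mul, Zsqrtd.norm_mul, hwm]
        have hpow : ∀ (x : GaussianInt) (n : ℕ), (x ^ n).norm = x.norm ^ n := fun x n =>
          map_pow (Zsqrtd.normMonoidHom) x n
        rw [hpow, hpow, Zsqrtd.norm_conj, hϖn]
      have h2 := mul_right_cancel₀ (by exact_mod_cast hm0 : (m : ℤ) ≠ 0) h1
      rw [← pow_mul, ← pow_mul, ← pow_add, ← mul_add] at h2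
      exact Nat.pow_right_injective hp.two_le (by exact_mod_cast h2)
    have hij' : a / e = i + j := by rw [← hij, Nat.mul_div_cancel_left _ he]
    have hia : i ≤ a := by nlinarith
    refine ⟨(i, w), ⟨by simp; omega, hwm⟩, ?_⟩
    simp only [F]
    rw [hij', Nat.add_sub_cancel_left, ← hw]
  calc _ ≤ (F '' ((Finset.range (a + 1) : Set ℕ) ×ˢ S)).ncard := Set.ncard_le_ncard hsub (hfin.image F)
    _ ≤ ((Finset.range (a + 1) : Set ℕ) ×ˢ S).ncard := Set.ncard_image_le hfin
    _ = _ := by rw [Set.ncard_prod, Set.ncard_coe_finset, Finset.card_range]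

theorem ncard_norm_one_le : {z : GaussianInt | z.norm = 1}.ncard ≤ 9 := by
  have hsub : {z : GaussianInt | z.norm = 1} ⊆
      (fun p : ℤ × ℤ => (⟨p.1, p.2⟩ : GaussianInt)) ''
        ((Finset.Icc (-1) 1 ×ˢ Finset.Icc (-1) 1 : Finset (ℤ × ℤ)) : Set (ℤ × ℤ)) := by
    rintro ⟨x, y⟩ h
    simp only [Set.mem_ofPred_eq, Zsqrtd.norm_def] at h
    refine ⟨(x, y), ?_, rfl⟩
    simp only [Finset.coe_product, Set.mem_prod, Finset.coe_Icc, Set.mem_Icc]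
    have h' : x * x + y * y = 1 := by linarith
    refine ⟨⟨?_, ?_⟩, ⟨?_, ?_⟩⟩ <;> nlinarith [mul_self_nonneg x, mul_self_nonneg y]
  refine (Set.ncard_le_ncard hsub ((Finset.finite_toSet _).image _)).trans ?_
  refine (Set.ncard_image_le (Finset.finite_toSet _)).trans ?_
  rw [Set.ncard_coe_finset]; decide

/-- Splitting off the full power `p ^ a` of the least prime factor multiplies the divisor count by
exactly `a + 1` and the Gaussian count by at most that. The `9` is a crude count of the units. -/
theorem ncard_norm_le_card_divisors (n : ℕ) (hn : n ≠ 0) :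
    {z : GaussianInt | z.norm = (n : ℤ)}.ncard ≤ 9 * n.divisors.card := by
  induction n using Nat.strong_induction_on with
  | _ n ih =>
    by_cases h1 : n = 1
    · subst h1; simpa using ncard_norm_one_le
    obtain ⟨a, m, hm, hnm⟩ := Nat.exists_eq_pow_mul_and_not_dvd hn n.minFac
      (Nat.minFac_prime h1).ne_one
    have hp := Nat.minFac_prime h1
    have hd : n.minFac ∣ n := Nat.minFac_dvd n
    generalize n.minFac = p at *
    subst hnm
    have ha : 0 < a := by
      rcases Nat.eq_zero_or_pos a with rfl | h
      · exact absurd (by simpa using hd) hm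
      · exact h
    have hm0 : m ≠ 0 := by rintro rfl; simp at hn
    have hcop : Nat.Coprime (p ^ a) m := Nat.Coprime.pow_left _ ((Nat.Prime.coprime_iff_not_dvd hp).2 hm)
    rw [hcop.card_divisors_mul, Nat.divisors_prime_pow hp, Finset.card_map, Finset.card_range]
    refine (ncard_norm_prime_pow_mul_le hp hm a).trans ?_
    have hlt : m < p ^ a * m := by
      have : 1 < p ^ a := Nat.one_lt_pow ha.ne' hp.one_lt
      nlinarith [Nat.pos_of_ne_zero hm0]
    have := ih m hlt hm0
    nlinarith

/-- For `p ≥ 2 ^ (1/ε)` one has `p ^ (a ε) ≥ 2 ^ a ≥ a + 1`; each of the at most `P` smaller primes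
costs a factor `B`. -/
theorem card_divisors_le_rpow (ε : ℝ) (hε : 0 < ε) :
    ∃ C : ℝ, 0 < C ∧ ∀ n : ℕ, n ≠ 0 → (n.divisors.card : ℝ) ≤ C * (n : ℝ) ^ ε := by
  obtain ⟨P, hP⟩ := exists_nat_ge ((2 : ℝ) ^ ε⁻¹)
  set B : ℝ := max 1 (1 / (ε * Real.log 2)) with hB
  have hB1 : 1 ≤ B := le_max_left _ _
  have hl2 : 0 < ε * Real.log 2 := mul_pos hε (Real.log_pos (by norm_num))
  have hfac : ∀ p a : ℕ, p.Prime →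
      ((a + 1 : ℕ) : ℝ) ≤ (if p < P then B else 1) * ((p : ℝ) ^ a) ^ ε := by
    intro p a hp
    have hp0 : (0 : ℝ) ≤ p := by positivity
    rw [← Real.rpow_natCast, ← Real.rpow_mul hp0, mul_comm (a : ℝ) ε, Real.rpow_mul hp0,
      Real.rpow_natCast]
    split_ifs with h
    · have h2 : (2 : ℝ) ^ ε ≤ (p : ℝ) ^ ε :=
        Real.rpow_le_rpow (by norm_num) (by exact_mod_cast hp.two_le) hε.le
      have h3 : 1 + ε * Real.log 2 ≤ (2 : ℝ) ^ ε := by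
        rw [Real.rpow_def_of_pos (by norm_num), mul_comm (Real.log 2)]
        linarith [Real.add_one_le_exp (ε * Real.log 2)]
      have h4 : 1 + a * (ε * Real.log 2) ≤ ((p : ℝ) ^ ε) ^ a :=
        (one_add_mul_le_pow (by linarith) a).trans (pow_le_pow_left₀ (by linarith) (h3.trans h2) a)
      have h5 : 1 ≤ B * (ε * Real.log 2) := by
        calc 1 = (1 / (ε * Real.log 2)) * (ε * Real.log 2) := by field_simp
          _ ≤ _ := mul_le_mul_of_nonneg_right (le_max_right _ _) hl2.le
      have h6 : B * (1 + a * (ε * Real.log 2)) ≤ B * ((p : ℝ) ^ ε) ^ a :=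
        mul_le_mul_of_nonneg_left h4 (by linarith)
      push_cast
      nlinarith [(Nat.cast_nonneg a : (0 : ℝ) ≤ a)]
    · have h2 : (2 : ℝ) ≤ (p : ℝ) ^ ε := by
        have : ((2 : ℝ) ^ ε⁻¹) ^ ε ≤ (p : ℝ) ^ ε :=
          Real.rpow_le_rpow (by positivity) (hP.trans (by exact_mod_cast not_lt.1 h)) hε.le
        rwa [← Real.rpow_mul (by norm_num), inv_mul_cancel₀ hε.ne', Real.rpow_one] at this
      have h3 : ((a + 1 : ℕ) : ℝ) ≤ 2 ^ a := by exact_mod_cast Nat.lt_two_pow_self (n := a)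
      rw [one_mul]
      exact h3.trans (pow_le_pow_left₀ (by norm_num) h2 a)
  refine ⟨B ^ P, by positivity, fun n hn => ?_⟩
  rw [Nat.card_divisors hn]
  push_cast
  have hprod : (n : ℝ) ^ ε = ∏ p ∈ n.primeFactors, ((p : ℝ) ^ n.factorization p) ^ ε := by
    rw [Real.finsetProd_rpow _ _ fun i _ => by positivity]
    congr 1
    conv_lhs => rw [← Nat.prod_factorization_pow_eq_self hn]
    rw [Finsupp.prod, Nat.support_factorization]; push_cast; rfl
  rw [hprod]
  calc _ ≤ ∏ p ∈ n.primeFactors, (if p < P then B else 1) * ((p : ℝ) ^ n.factorization p) ^ ε := by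
        refine Finset.prod_le_prod (fun _ _ => by positivity) fun p hp => ?_
        exact_mod_cast hfac p _ (Nat.prime_of_mem_primeFactors hp)
    _ = (∏ p ∈ n.primeFactors, (if p < P then B else 1)) * _ := Finset.prod_mul_distrib
    _ ≤ _ := by
        refine mul_le_mul_of_nonneg_right ?_ (Finset.prod_nonneg fun _ _ => by positivity)
        rw [← Finset.prod_filter, Finset.prod_const]
        refine pow_le_pow_right₀ hB1 ?_
        calc _ ≤ (Finset.range P).card := Finset.card_le_card fun x hx => by
              simpa using (Finset.mem_filter.1 hx).2
          _ = P := Finset.card_range P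

theorem ncard_norm_eq_le_rpow (ε : ℝ) (hε : 0 < ε) :
    ∃ C : ℝ, 0 < C ∧ ∀ n : ℕ, n ≠ 0 →
      ({z : GaussianInt | z.norm = (n : ℤ)}.ncard : ℝ) ≤ C * (n : ℝ) ^ ε := by
  obtain ⟨C, hC, h⟩ := card_divisors_le_rpow ε hε
  refine ⟨9 * C, by positivity, fun n hn => ?_⟩
  have h1 : ({z : GaussianInt | z.norm = (n : ℤ)}.ncard : ℝ) ≤ 9 * n.divisors.card := by
    exact_mod_cast ncard_norm_le_card_divisors n hn
  nlinarith [h n hn]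

/-- Circumradius formula: the product of the squared sides of a triangle is `16 R² area²`. Here `R²
= n`, and twice the area is, up to sign, the nonzero integer `c`. -/
theorem four_mul_le_of_three_points {n x₁ y₁ x₂ y₂ x₃ y₃ : ℤ} (hn : 0 < n)
    (h₁ : x₁ ^ 2 + y₁ ^ 2 = n) (h₂ : x₂ ^ 2 + y₂ ^ 2 = n) (h₃ : x₃ ^ 2 + y₃ ^ 2 = n)
    (h₁₂ : (x₁ - x₂) ^ 2 + (y₁ - y₂) ^ 2 ≠ 0) (h₂₃ : (x₂ - x₃) ^ 2 + (y₂ - y₃) ^ 2 ≠ 0)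
    (h₃₁ : (x₃ - x₁) ^ 2 + (y₃ - y₁) ^ 2 ≠ 0) :
    4 * n ≤ ((x₁ - x₂) ^ 2 + (y₁ - y₂) ^ 2) * ((x₂ - x₃) ^ 2 + (y₂ - y₃) ^ 2) *
      ((x₃ - x₁) ^ 2 + (y₃ - y₁) ^ 2) := by
  -- The Gram determinant of three vectors in the plane vanishes.
  have gram : ∀ u v w : ℤ × ℤ, (u.1 ^ 2 + u.2 ^ 2) * (v.1 ^ 2 + v.2 ^ 2) * (w.1 ^ 2 + w.2 ^ 2) +
      2 * (u.1 * v.1 + u.2 * v.2) * (u.1 * w.1 + u.2 * w.2) * (v.1 * w.1 + v.2 * w.2) -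
      (u.1 ^ 2 + u.2 ^ 2) * (v.1 * w.1 + v.2 * w.2) ^ 2 -
      (v.1 ^ 2 + v.2 ^ 2) * (u.1 * w.1 + u.2 * w.2) ^ 2 -
      (w.1 ^ 2 + w.2 ^ 2) * (u.1 * v.1 + u.2 * v.2) ^ 2 = 0 := fun u v w => by ring
  have hg := gram (x₁, y₁) (x₂, y₂) (x₃, y₃)
  simp only [h₁, h₂, h₃] at hg
  obtain ⟨p, hp⟩ : ∃ p, p = x₁ * x₂ + y₁ * y₂ := ⟨_, rfl⟩
  obtain ⟨q, hq⟩ : ∃ q, q = x₁ * x₃ + y₁ * y₃ := ⟨_, rfl⟩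
  obtain ⟨r, hr⟩ : ∃ r, r = x₂ * x₃ + y₂ * y₃ := ⟨_, rfl⟩
  obtain ⟨c, hc⟩ : ∃ c, c = (x₂ - x₁) * (y₃ - y₁) - (y₂ - y₁) * (x₃ - x₁) := ⟨_, rfl⟩
  rw [← hp, ← hq, ← hr] at hg
  have e₁₂ : (x₁ - x₂) ^ 2 + (y₁ - y₂) ^ 2 = 2 * (n - p) := by
    linear_combination h₁ + h₂ + 2 * hp
  have e₂₃ : (x₂ - x₃) ^ 2 + (y₂ - y₃) ^ 2 = 2 * (n - r) := by
    linear_combination h₂ + h₃ + 2 * hr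
  have e₃₁ : (x₃ - x₁) ^ 2 + (y₃ - y₁) ^ 2 = 2 * (n - q) := by
    linear_combination h₁ + h₃ + 2 * hq
  have hdot : (x₂ - x₁) * (x₃ - x₁) + (y₂ - y₁) * (y₃ - y₁) = n + r - p - q := by
    linear_combination h₁ - hr + hp + hq
  have lagrange : c ^ 2 = ((x₁ - x₂) ^ 2 + (y₁ - y₂) ^ 2) * ((x₃ - x₁) ^ 2 + (y₃ - y₁) ^ 2) -
      ((x₂ - x₁) * (x₃ - x₁) + (y₂ - y₁) * (y₃ - y₁)) ^ 2 := by rw [hc]; ring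
  rw [e₁₂, e₃₁, hdot] at lagrange
  have key : ((x₁ - x₂) ^ 2 + (y₁ - y₂) ^ 2) * ((x₂ - x₃) ^ 2 + (y₂ - y₃) ^ 2) *
      ((x₃ - x₁) ^ 2 + (y₃ - y₁) ^ 2) = 4 * n * c ^ 2 := by
    rw [e₁₂, e₂₃, e₃₁, lagrange]
    linear_combination (-4) * hg
  have hc0 : c ≠ 0 := by
    intro h
    rw [h] at key
    exact mul_ne_zero (mul_ne_zero h₁₂ h₂₃) h₃₁ (by rw [key]; ring)
  have hc1 : 1 ≤ c ^ 2 := Int.add_one_le_of_lt (by positivity : 0 < c ^ 2)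
  rw [key]
  exact le_mul_of_one_le_right (by positivity) hc1

theorem one_le_spaceBracket (k : Freq) : 1 ≤ spaceBracket k := by
  rw [spaceBracket, Real.one_le_sqrt]
  have : 0 ≤ freqSq k := Finset.sum_nonneg fun _ _ => sq_nonneg _
  linarith

theorem freqSq_eq (k : Freq) : freqSq k = (k 0 : ℝ) ^ 2 + (k 1 : ℝ) ^ 2 := by
  simp [freqSq, Fin.sum_univ_two]

theorem freqSq_nonneg (k : Freq) : 0 ≤ freqSq k := Finset.sum_nonneg fun _ _ => sq_nonneg _

theorem spaceBracket_sq (k : Freq) : spaceBracket k ^ 2 = 1 + freqSq k :=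
  Real.sq_sqrt (by linarith [freqSq_nonneg k])

theorem dist_sq_le_of_spaceBracket_le {i j : Freq} {D : ℝ} (hi : spaceBracket i ≤ D)
    (hj : spaceBracket j ≤ D) :
    ((i 0 - j 0 : ℤ) : ℝ) ^ 2 + ((i 1 - j 1 : ℤ) : ℝ) ^ 2 ≤ 4 * D ^ 2 := by
  have h1 : spaceBracket i ^ 2 ≤ D ^ 2 :=
    pow_le_pow_left₀ (zero_le_one.trans (one_le_spaceBracket i)) hi 2
  have h2 : spaceBracket j ^ 2 ≤ D ^ 2 :=
    pow_le_pow_left₀ (zero_le_one.trans (one_le_spaceBracket j)) hj 2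
  rw [spaceBracket_sq, freqSq_eq] at h1 h2
  push_cast
  nlinarith [sq_nonneg ((i 0 : ℝ) + j 0), sq_nonneg ((i 1 : ℝ) + j 1)]

/-- The lattice points on a circle, weighted by a negative power of the distance to a given
lattice point, have a bounded sum. -/
theorem sum_spaceBracket_rpow_circle_le (δ : ℝ) (hδ : 0 < δ) :
    ∃ A : ℝ, 0 < A ∧ ∀ (k : Freq) (m : ℝ) (S : Finset Freq),
      (∀ j ∈ S, freqSq j + freqSq (k - j) = m) → ∑ j ∈ S, spaceBracket j ^ (-δ) ≤ A := by
  obtain ⟨C, hC, hcount⟩ := ncard_norm_eq_le_rpow (δ / 6) (by positivity)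
  -- The `2` bounds the points near the origin; the other term is the number `C * n ^ (δ / 6)` of
  -- far points times their weight `D ^ (-δ)`, where `D ^ 6 = n / 2000`.
  refine ⟨2 + C * 2000 ^ (δ / 6), by positivity, fun k m S hS => ?_⟩
  have hle1 : ∀ j, spaceBracket j ^ (-δ) ≤ 1 := fun j =>
    Real.rpow_le_one_of_one_le_of_nonpos (one_le_spaceBracket j) (by linarith)
  -- Completing the square: `|j|² + |k - j|² = m` says that `2j - k` has norm `2m - |k|²`.
  let φ : Freq → GaussianInt := fun j => ⟨2 * j 0 - k 0, 2 * j 1 - k 1⟩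
  have hφ : Function.Injective φ := by
    intro i j hij
    simp only [φ, Zsqrtd.mk.injEq] at hij
    ext a
    fin_cases a
    · simp only [Fin.zero_eta]; omega
    · simp only [Fin.mk_one]; omega
  rcases S.eq_empty_or_nonempty with rfl | ⟨j₀, hj₀⟩
  · simp; positivity
  have hnorm : ∀ j ∈ S, (((φ j).norm : ℤ) : ℝ) = 2 * m - freqSq k := by
    intro j hj
    rw [← hS j hj]
    simp only [φ, Zsqrtd.norm_def, freqSq_eq, Pi.sub_apply]
    push_cast; ring
  obtain ⟨n, hn⟩ : ∃ n : ℕ, (φ j₀).norm = n := ⟨_, (GaussianInt.abs_natCast_norm _).symm⟩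
  have hnorm' : ∀ j ∈ S, (φ j).norm = (n : ℤ) := by
    intro j hj
    rw [← hn]
    have := (hnorm j hj).trans (hnorm j₀ hj₀).symm
    exact_mod_cast this
  rcases Nat.eq_zero_or_pos n with h0 | hpos
  · have : S.card ≤ 1 := by
      rw [Finset.card_le_one]
      intro i hi j hj
      apply hφ
      rw [GaussianInt.norm_eq_zero.1 ((hnorm' i hi).trans (by simp [h0])),
        GaussianInt.norm_eq_zero.1 ((hnorm' j hj).trans (by simp [h0]))]
    calc _ ≤ ∑ j ∈ S, (1 : ℝ) := Finset.sum_le_sum fun j _ => hle1 j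
      _ ≤ 1 := by simp only [Finset.sum_const, nsmul_eq_mul, mul_one]; exact_mod_cast this
      _ ≤ _ := by have : 0 < C * 2000 ^ (δ / 6) := by positivity
                  linarith
  have hn0 : (0 : ℝ) < n := by exact_mod_cast hpos
  -- Three near points would give, after doubling, squared distances at most `16 D²`, with product
  -- at most `4096 D ^ 6 = (4096 / 2000) n < 4 n`, against `four_mul_le_of_three_points`.
  set D : ℝ := ((n : ℝ) / 2000) ^ (1 / 6 : ℝ) with hD
  have hD0 : 0 < D := by positivity
  have hD6 : D ^ 6 = n / 2000 := by
    rw [hD, ← Real.rpow_natCast, ← Real.rpow_mul (by positivity)]; norm_num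
  rw [← Finset.sum_filter_add_sum_filter_not S (fun j => spaceBracket j ≤ D)]
  refine add_le_add ?_ ?_
  · have hcard : (S.filter fun j => spaceBracket j ≤ D).card ≤ 2 := by
      by_contra hlt
      push Not at hlt
      obtain ⟨a, b, c, ha, hb, hc, hab, hac, hbc⟩ := Finset.two_lt_card_iff.1 hlt
      simp only [Finset.mem_filter] at ha hb hc
      have hcirc : ∀ j ∈ S, (2 * j 0 - k 0) ^ 2 + (2 * j 1 - k 1) ^ 2 = (n : ℤ) := by
        intro j hj
        rw [← hnorm' j hj]; simp only [φ, Zsqrtd.norm_def]; ring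
      have hne : ∀ i j : Freq, i ≠ j →
          (2 * i 0 - k 0 - (2 * j 0 - k 0)) ^ 2 + (2 * i 1 - k 1 - (2 * j 1 - k 1)) ^ 2 ≠ 0 := by
        intro i j hij h
        apply hij
        have h1 : (2 * i 0 - k 0 - (2 * j 0 - k 0)) = 0 := by nlinarith
        have h2 : (2 * i 1 - k 1 - (2 * j 1 - k 1)) = 0 := by nlinarith
        ext x
        fin_cases x
        · simp only [Fin.zero_eta]; omega
        · simp only [Fin.mk_one]; omega
      have hbd : ∀ i j : Freq, spaceBracket i ≤ D → spaceBracket j ≤ D →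
          (((2 * i 0 - k 0 - (2 * j 0 - k 0)) ^ 2 +
            (2 * i 1 - k 1 - (2 * j 1 - k 1)) ^ 2 : ℤ) : ℝ) ≤ 16 * D ^ 2 := by
        intro i j hi hj
        have := dist_sq_le_of_spaceBracket_le hi hj
        push_cast at this ⊢
        nlinarith
      have h4 := four_mul_le_of_three_points (by exact_mod_cast hpos : (0 : ℤ) < n)
        (hcirc a ha.1) (hcirc b hb.1) (hcirc c hc.1) (hne a b hab) (hne b c hbc)
        (hne c a hac.symm)
      have h5 : (4 * (n : ℝ)) ≤ (16 * D ^ 2) * (16 * D ^ 2) * (16 * D ^ 2) := by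
        have h7 := (Int.cast_le (R := ℝ)).2 h4
        rw [Int.cast_mul, Int.cast_mul, Int.cast_mul, Int.cast_natCast, Int.cast_ofNat] at h7
        refine h7.trans ?_
        have h1 := hbd a b ha.2 hb.2
        have h2 := hbd b c hb.2 hc.2
        have h3 := hbd c a hc.2 ha.2
        have p1 : (0 : ℝ) ≤ (((2 * b 0 - k 0 - (2 * c 0 - k 0)) ^ 2 +
            (2 * b 1 - k 1 - (2 * c 1 - k 1)) ^ 2 : ℤ) : ℝ) := by push_cast; positivity
        have p2 : (0 : ℝ) ≤ (((2 * c 0 - k 0 - (2 * a 0 - k 0)) ^ 2 +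
            (2 * c 1 - k 1 - (2 * a 1 - k 1)) ^ 2 : ℤ) : ℝ) := by push_cast; positivity
        exact mul_le_mul (mul_le_mul h1 h2 p1 (by positivity)) h3 p2 (by positivity)
      have h6 : (16 * D ^ 2) * (16 * D ^ 2) * (16 * D ^ 2) = 4096 * D ^ 6 := by ring
      rw [h6, hD6] at h5
      linarith
    calc _ ≤ ∑ j ∈ S with spaceBracket j ≤ D, (1 : ℝ) := Finset.sum_le_sum fun j _ => hle1 j
      _ ≤ 2 := by simp only [Finset.sum_const, nsmul_eq_mul, mul_one]; exact_mod_cast hcard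
  · have hfar : ∀ j ∈ S.filter (fun j => ¬ spaceBracket j ≤ D),
        spaceBracket j ^ (-δ) ≤ D ^ (-δ) := by
      intro j hj
      exact Real.rpow_le_rpow_of_nonpos hD0 (not_le.1 (Finset.mem_filter.1 hj).2).le (by linarith)
    have hcard : ((S.filter fun j => ¬ spaceBracket j ≤ D).card : ℝ) ≤ C * (n : ℝ) ^ (δ / 6) := by
      refine le_trans ?_ (hcount n hpos.ne')
      have : (S.filter fun j => ¬ spaceBracket j ≤ D).card ≤
          {z : GaussianInt | z.norm = (n : ℤ)}.ncard := by
        rw [← Finset.card_image_of_injective _ hφ, ← Set.ncard_coe_finset]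
        refine Set.ncard_le_ncard ?_ (finite_gaussianInt_norm_eq n)
        intro z hz
        simp only [Finset.coe_image, Set.mem_image, Finset.mem_coe, Finset.mem_filter] at hz
        obtain ⟨j, ⟨hj, -⟩, rfl⟩ := hz
        exact hnorm' j hj
      exact_mod_cast this
    calc _ ≤ ∑ j ∈ S with ¬ spaceBracket j ≤ D, D ^ (-δ) := Finset.sum_le_sum hfar
      _ = _ * D ^ (-δ) := by rw [Finset.sum_const, nsmul_eq_mul]
      _ ≤ C * (n : ℝ) ^ (δ / 6) * D ^ (-δ) := mul_le_mul_of_nonneg_right hcard (by positivity)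
      _ = C * 2000 ^ (δ / 6) := by
        rw [hD, ← Real.rpow_mul (by positivity), mul_assoc]
        congr 1
        rw [show (1 / 6 : ℝ) * -δ = -(δ / 6) by ring, Real.rpow_neg (by positivity),
          Real.div_rpow hn0.le (by norm_num)]
        field_simp

end Counting

/-! ### Resonance sums and time integrals of modulation weights -/

section Weights

theorem summable_one_add_abs_int_rpow {γ : ℝ} (hγ : 1 < γ) :
    Summable fun j : ℤ => (1 + |(j : ℝ)|) ^ (-γ) := by
  refine Summable.of_norm_bounded_eventually (g := fun j : ℤ => |(j : ℝ)| ^ (-γ))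
    (Real.summable_abs_int_rpow hγ) ?_
  filter_upwards [Filter.eventually_cofinite_ne (0 : ℤ)] with j hj
  have hj' : 0 < |(j : ℝ)| := abs_pos.2 (by exact_mod_cast hj)
  rw [Real.norm_of_nonneg (by positivity)]
  exact Real.rpow_le_rpow_of_nonpos hj' (by linarith) (by linarith)

/-- Replacing `y` by its floor costs a factor `2 ^ γ` and leaves part of a fixed convergent series
over `ℤ`. -/
theorem exists_sum_one_add_abs_sub_rpow_le {γ : ℝ} (hγ : 1 < γ) :
    ∃ B : ℝ, 0 ≤ B ∧ ∀ (y : ℝ) (F : Finset ℕ), ∑ n ∈ F, (1 + |y - n|) ^ (-γ) ≤ B := by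
  refine ⟨2 ^ γ * ∑' j : ℤ, (1 + |(j : ℝ)|) ^ (-γ),
    mul_nonneg (by positivity) (tsum_nonneg fun _ => by positivity), fun y F => ?_⟩
  have hinj : Function.Injective fun n : ℕ => ⌊y⌋ - (n : ℤ) := fun a b h => by
    simp only at h; omega
  calc ∑ n ∈ F, (1 + |y - n|) ^ (-γ)
      ≤ ∑ n ∈ F, 2 ^ γ * (1 + |((⌊y⌋ - (n : ℤ) : ℤ) : ℝ)|) ^ (-γ) := by
        refine Finset.sum_le_sum fun n _ => ?_
        have h1 : (1 + |((⌊y⌋ - (n : ℤ) : ℤ) : ℝ)|) / 2 ≤ 1 + |y - n| := by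
          push_cast
          have h2 : |(⌊y⌋ : ℝ) - n| ≤ |(⌊y⌋ : ℝ) - y| + |y - n| := abs_sub_le _ _ _
          have h3 : |(⌊y⌋ : ℝ) - y| ≤ 1 := by
            rw [abs_le]; constructor <;> linarith [Int.floor_le y, Int.lt_floor_add_one y]
          linarith [abs_nonneg (y - n)]
        refine (Real.rpow_le_rpow_of_nonpos (by positivity) h1 (by linarith)).trans_eq ?_
        rw [Real.div_rpow (by positivity) (by norm_num), Real.rpow_neg (by norm_num : (0:ℝ) ≤ 2)]
        field_simp
    _ = 2 ^ γ * ∑ j ∈ F.image (fun n : ℕ => ⌊y⌋ - (n : ℤ)), (1 + |(j : ℝ)|) ^ (-γ) := by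
        rw [Finset.sum_image fun a _ b _ h => hinj h, Finset.mul_sum]
    _ ≤ _ := mul_le_mul_of_nonneg_left
        ((summable_one_add_abs_int_rpow hγ).sum_le_tsum _ fun _ _ => by positivity) (by positivity)

/-- The bound must not depend on the period. With `σ` represented in `[0, T)` and `n` in `[0, T)`,
the circle distance is attained at one of three translates, each a sum on the line. -/
theorem exists_sum_one_add_norm_addCircle_rpow_le {γ : ℝ} (hγ : 1 < γ) :
    ∃ B : ℝ, 0 ≤ B ∧ ∀ (T : ℝ) [Fact (0 < T)] (σ : AddCircle T) (F : Finset ℕ),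
      (∀ n ∈ F, (n : ℝ) < T) →
      ∑ n ∈ F, (1 + ‖σ - ((n : ℝ) : AddCircle T)‖) ^ (-γ) ≤ B := by
  obtain ⟨B, hB, h⟩ := exists_sum_one_add_abs_sub_rpow_le hγ
  refine ⟨3 * B, by positivity, fun T hT σ F hF => ?_⟩
  have hT0 : 0 < T := hT.out
  obtain ⟨s, hs, rfl⟩ : ∃ s ∈ Set.Ico 0 T, (s : AddCircle T) = σ := by
    obtain ⟨s, hs⟩ := (AddCircle.equivIco T 0).symm.surjective σ
    exact ⟨s, by simpa using s.2, hs⟩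
  have key : ∀ n ∈ F, (1 + ‖(s : AddCircle T) - ((n : ℝ) : AddCircle T)‖) ^ (-γ) ≤
      (1 + |s - n|) ^ (-γ) + (1 + |s - T - n|) ^ (-γ) + (1 + |s + T - n|) ^ (-γ) := by
    intro n hn
    have p : ∀ x : ℝ, 0 ≤ (1 + |x|) ^ (-γ) := fun x => by positivity
    rw [← AddCircle.coe_sub, AddCircle.norm_eq]
    have h1 : T⁻¹ * (s - n) < 1 := by
      rw [inv_mul_lt_iff₀ hT0]; linarith [hs.2, (Nat.cast_nonneg n : (0:ℝ) ≤ n)]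
    have h2 : -1 < T⁻¹ * (s - n) := by
      rw [lt_inv_mul_iff₀ hT0]; linarith [hs.1, hF n hn]
    have h3 : round (T⁻¹ * (s - n)) < 2 := by
      rw [round_eq, Int.floor_lt]; push_cast; linarith
    have h4 : -1 ≤ round (T⁻¹ * (s - n)) := by
      rw [round_eq, Int.le_floor]; push_cast; linarith
    generalize round (T⁻¹ * (s - n)) = r at h3 h4
    interval_cases r
    · rw [show s - (n : ℝ) - ((-1 : ℤ) : ℝ) * T = s + T - n by push_cast; ring]
      linarith [p (s - n), p (s - T - n)]
    · rw [show s - (n : ℝ) - ((0 : ℤ) : ℝ) * T = s - n by push_cast; ring]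
      linarith [p (s + T - n), p (s - T - n)]
    · rw [show s - (n : ℝ) - ((1 : ℤ) : ℝ) * T = s - T - n by push_cast; ring]
      linarith [p (s - n), p (s + T - n)]
  refine (Finset.sum_le_sum key).trans ?_
  rw [Finset.sum_add_distrib, Finset.sum_add_distrib]
  linarith [h s F, h (s - T) F, h (s + T) F]

theorem exists_freqSq_eq_natCast (k : Freq) : ∃ n : ℕ, freqSq k = n := by
  refine ⟨(k 0 ^ 2 + k 1 ^ 2).natAbs, ?_⟩
  rw [freqSq_eq, Nat.cast_natAbs, abs_of_nonneg (by positivity)]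
  push_cast; ring

theorem freqSq_le_of_mem_lowFreq {τ : ℝ} (hτ : 0 < τ) {k : Freq} (hk : k ∈ lowFreq τ) :
    freqSq k ≤ 2 / τ := by
  rw [mem_lowFreq] at hk
  have h2 : (τ ^ (-(1 / 2) : ℝ)) ^ 2 = 1 / τ := by
    rw [← Real.rpow_natCast, ← Real.rpow_mul hτ.le]
    norm_num [Real.rpow_neg_one]
  have h : ∀ i, (k i : ℝ) ^ 2 ≤ 1 / τ := fun i => by
    rw [← h2, ← sq_abs]; exact pow_le_pow_left₀ (abs_nonneg _) (hk i) 2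
  rw [freqSq_eq, show 2 / τ = 1 / τ + 1 / τ by ring]
  exact add_le_add (h 0) (h 1)

/-- Bourgain's counting estimate: the resonance function takes each value few times. -/
theorem exists_sum_resonance_le {γ δ : ℝ} (hγ : 1 < γ) (hδ : 0 < δ) :
    ∃ B : ℝ, 0 ≤ B ∧ ∀ (τ : ℝ) [Fact (0 < τ)] (k : Freq) (σ : AddCircle (2 * π / τ))
      (S : Finset Freq), (∀ j ∈ S, j ∈ lowFreq τ ∧ k - j ∈ lowFreq τ) →
      ∑ j ∈ S, spaceBracket j ^ (-δ) *
        (1 + ‖σ - ((freqSq j + freqSq (k - j) : ℝ) : AddCircle (2 * π / τ))‖) ^ (-γ) ≤ B := by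
  obtain ⟨A, hA, hcirc⟩ := sum_spaceBracket_rpow_circle_le δ hδ
  obtain ⟨B, hB, htime⟩ := exists_sum_one_add_norm_addCircle_rpow_le hγ
  refine ⟨A * B, by positivity, fun τ hτ k σ S hS => ?_⟩
  have hτ0 : 0 < τ := hτ.out
  choose q hq using exists_freqSq_eq_natCast
  let ν : Freq → ℕ := fun j => q j + q (k - j)
  have hν : ∀ j, freqSq j + freqSq (k - j) = ν j := fun j => by
    simp only [ν, hq]; push_cast; rfl
  -- Since `4 < 2π`, the filter confines the values of the resonance function to one period: there
  -- is no aliasing.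
  have hT : ∀ n ∈ S.image ν, (n : ℝ) < 2 * π / τ := by
    intro n hn
    obtain ⟨j, hj, rfl⟩ := Finset.mem_image.1 hn
    rw [← hν]
    have h1 := freqSq_le_of_mem_lowFreq hτ0 (hS j hj).1
    have h2 := freqSq_le_of_mem_lowFreq hτ0 (hS j hj).2
    calc _ ≤ 2 / τ + 2 / τ := add_le_add h1 h2
      _ = 4 / τ := by ring
      _ < 2 * π / τ := by
        apply div_lt_div_of_pos_right _ hτ0
        linarith [Real.pi_gt_three]
  rw [← Finset.sum_fiberwise_of_maps_to (g := ν) (t := S.image ν)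
    fun j hj => Finset.mem_image_of_mem ν hj]
  calc _ ≤ ∑ n ∈ S.image ν, A * (1 + ‖σ - ((n : ℝ) : AddCircle (2 * π / τ))‖) ^ (-γ) := by
        refine Finset.sum_le_sum fun n _ => ?_
        have : ∀ j ∈ S.filter (fun j => ν j = n), spaceBracket j ^ (-δ) *
            (1 + ‖σ - ((freqSq j + freqSq (k - j) : ℝ) : AddCircle (2 * π / τ))‖) ^ (-γ) =
            spaceBracket j ^ (-δ) * (1 + ‖σ - ((n : ℝ) : AddCircle (2 * π / τ))‖) ^ (-γ) := by
          intro j hj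
          rw [hν, (Finset.mem_filter.1 hj).2]
        rw [Finset.sum_congr rfl this, ← Finset.sum_mul]
        refine mul_le_mul_of_nonneg_right (hcirc k n _ fun j hj => ?_) (by positivity)
        rw [hν, (Finset.mem_filter.1 hj).2]
    _ = A * ∑ n ∈ S.image ν, (1 + ‖σ - ((n : ℝ) : AddCircle (2 * π / τ))‖) ^ (-γ) := by
        rw [Finset.mul_sum]
    _ ≤ A * B := mul_le_mul_of_nonneg_left (htime _ σ _ hT) hA.le

theorem summable_spaceBracket_rpow {r : ℝ} (hr : 2 < r) :
    Summable fun j : Freq => spaceBracket j ^ (-r) := by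
  refine Summable.of_norm_bounded_eventually (g := fun j : Freq => ‖j‖ ^ (-r))
    (EisensteinSeries.summable_one_div_norm_rpow hr) ?_
  filter_upwards [Filter.eventually_cofinite_ne (0 : Freq)] with j hj
  have hj' : 0 < ‖j‖ := norm_pos_iff.2 hj
  have h1 : (0 : ℝ) < spaceBracket j := zero_lt_one.trans_le (one_le_spaceBracket j)
  rw [Real.norm_of_nonneg (by positivity)]
  refine Real.rpow_le_rpow_of_nonpos hj' ?_ (by linarith)
  refine (pi_norm_le_iff_of_nonneg h1.le).2 fun i => ?_
  rw [Int.norm_eq_abs, spaceBracket]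
  refine Real.abs_le_sqrt ?_
  have : (j i : ℝ) ^ 2 ≤ freqSq j :=
    Finset.single_le_sum (f := fun i => (j i : ℝ) ^ 2) (fun _ _ => sq_nonneg _) (Finset.mem_univ i)
  linarith

/-- Weighted AM-GM interpolates between plain summability in `j` (weight `1 - θ`, no time decay) and
the resonance estimate (weight `θ`, time exponent `β / θ > 1`). -/
theorem exists_sum_weighted_resonance_le {s β : ℝ} (hβ : 0 < β) (hβ1 : β < 1)
    (hsβ : 1 - s < β) :
    ∃ B : ℝ, 0 ≤ B ∧ ∀ (τ : ℝ) [Fact (0 < τ)] (k : Freq) (σ : AddCircle (2 * π / τ))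
      (S : Finset Freq), (∀ j ∈ S, j ∈ lowFreq τ ∧ k - j ∈ lowFreq τ) →
      ∑ j ∈ S, spaceBracket j ^ (-(2 * s)) *
        (1 + ‖σ - ((freqSq j + freqSq (k - j) : ℝ) : AddCircle (2 * π / τ))‖) ^ (-β) ≤ B := by
  obtain ⟨θ, hθ, hθβ⟩ := exists_between (max_lt hβ hsβ)
  obtain ⟨hθ0, hθs⟩ := max_lt_iff.1 hθ
  -- Half of the gap between `s` and `1 - θ`: `s - ε` still exceeds `1 - θ`, and a positive power of
  -- the bracket remains for the resonance estimate.
  set ε := (s - 1 + θ) / 2 with hε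
  have hε0 : 0 < ε := by rw [hε]; linarith
  have hθ1 : 0 < 1 - θ := by linarith
  have hr : 2 < 2 * (s - ε) / (1 - θ) := by
    rw [lt_div_iff₀ hθ1, hε]; linarith
  obtain ⟨B, hB, hres⟩ := exists_sum_resonance_le (γ := β / θ) (δ := 2 * ε / θ)
    ((one_lt_div hθ0).2 hθβ) (by positivity)
  refine ⟨(∑' j : Freq, spaceBracket j ^ (-(2 * (s - ε) / (1 - θ)))) + B,
    add_nonneg (tsum_nonneg fun j => Real.rpow_nonneg (Real.sqrt_nonneg _) _) hB,
    fun τ _ k σ S hS => ?_⟩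
  refine le_trans (Finset.sum_le_sum fun j _ => ?_) ((Finset.sum_add_distrib).trans_le
    (add_le_add ((summable_spaceBracket_rpow hr).sum_le_tsum S
      fun j _ => Real.rpow_nonneg (Real.sqrt_nonneg _) _) (hres τ k σ S hS)))
  have hj : 0 < spaceBracket j := zero_lt_one.trans_le (one_le_spaceBracket j)
  generalize spaceBracket j = a at hj
  have hy : 0 < 1 + ‖σ - ((freqSq j + freqSq (k - j) : ℝ) : AddCircle (2 * π / τ))‖ := by positivity
  generalize 1 + ‖σ - ((freqSq j + freqSq (k - j) : ℝ) : AddCircle (2 * π / τ))‖ = y at hy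
  have h := Real.geom_mean_le_arith_mean2_weighted hθ1.le hθ0.le
    (Real.rpow_nonneg hj.le (-(2 * (s - ε) / (1 - θ))))
    (mul_nonneg (Real.rpow_nonneg hj.le (-(2 * ε / θ))) (Real.rpow_nonneg hy.le (-(β / θ)))) (by ring)
  rw [Real.mul_rpow (by positivity) (by positivity), ← Real.rpow_mul hj.le, ← Real.rpow_mul hj.le,
    ← Real.rpow_mul hy.le, ← mul_assoc, ← Real.rpow_add hj] at h
  have e1 : -(2 * (s - ε) / (1 - θ)) * (1 - θ) + -(2 * ε / θ) * θ = -(2 * s) := by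
    field_simp; ring
  have e2 : -(β / θ) * θ = -β := by field_simp
  rw [e1, e2] at h
  refine h.trans (add_le_add ?_ ?_)
  · exact mul_le_of_le_one_left (by positivity) (by linarith)
  · exact mul_le_of_le_one_left (by positivity) (by linarith)

/-- On the period centred at `0` the circle norm is `|x|`; the integral over the line then gives a
bound free of `T`. -/
theorem lintegral_one_add_norm_addCircle_le (γ : ℝ) (T : ℝ) [hT : Fact (0 < T)] :
    ∫⁻ x : AddCircle T, ENNReal.ofReal ((1 + ‖x‖) ^ (-γ)) ≤
      ∫⁻ x : ℝ, ENNReal.ofReal ((1 + ‖x‖) ^ (-γ)) := by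
  have hT0 : 0 < T := hT.out
  rw [← AddCircle.lintegral_preimage T (-(T / 2))]
  refine le_trans (le_of_eq ?_) (setLIntegral_le_lintegral (Set.Ioc (-(T / 2)) (-(T / 2) + T)) _)
  refine setLIntegral_congr_fun measurableSet_Ioc fun x hx => ?_
  have h : ‖(x : AddCircle T)‖ = |x| := by
    rw [AddCircle.norm_coe_eq_abs_iff T hT0.ne', abs_of_pos hT0, abs_le]
    constructor <;> linarith [hx.1, hx.2]
  simp only [h, Real.norm_eq_abs]

/-- The larger of `a` and `b` is at least `c / 2` and supplies `c ^ (-β)`; its remaining decay is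
traded for the same power of the smaller one. -/
theorem rpow_mul_rpow_le_of_le_add {a b c ρ β : ℝ} (ha : 0 < a) (hb : 0 < b) (hc : 0 < c)
    (hβ : 0 ≤ β) (hβρ : β ≤ ρ) (h : c ≤ a + b) :
    a ^ (-ρ) * b ^ (-ρ) ≤ 2 ^ β * (a ^ (-(2 * ρ - β)) + b ^ (-(2 * ρ - β))) * c ^ (-β) := by
  wlog hab : a ≤ b generalizing a b
  · rw [mul_comm (a ^ _), add_comm (a ^ _)]
    exact this hb ha (by linarith) (le_of_not_ge hab)
  have h1 : b ^ (-β) ≤ 2 ^ β * c ^ (-β) := by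
    have : (c / 2) ^ β ≤ b ^ β := Real.rpow_le_rpow (by positivity) (by linarith) hβ
    rw [Real.div_rpow hc.le (by norm_num)] at this
    rw [Real.rpow_neg hb.le, Real.rpow_neg hc.le, ← div_eq_mul_inv, inv_eq_one_div,
      div_le_div_iff₀ (by positivity) (by positivity)]
    rw [div_le_iff₀ (by positivity)] at this
    linarith
  have h2 : b ^ (-(ρ - β)) ≤ a ^ (-(ρ - β)) := Real.rpow_le_rpow_of_nonpos ha hab (by linarith)
  calc a ^ (-ρ) * b ^ (-ρ) = a ^ (-ρ) * (b ^ (-(ρ - β)) * b ^ (-β)) := by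
        rw [← Real.rpow_add hb]; ring_nf
    _ ≤ a ^ (-ρ) * (a ^ (-(ρ - β)) * (2 ^ β * c ^ (-β))) := by gcongr
    _ = 2 ^ β * a ^ (-(2 * ρ - β)) * c ^ (-β) := by
        rw [show -(2 * ρ - β) = -ρ + -(ρ - β) by ring, Real.rpow_add ha]; ring
    _ ≤ _ := by
        gcongr
        linarith [Real.rpow_nonneg hb.le (-(2 * ρ - β))]

theorem exists_lintegral_mul_rpow_le {ρ β : ℝ} (hβ : 0 ≤ β) (hβρ : β ≤ ρ) (h : 1 < 2 * ρ - β) :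
    ∃ C : ℝ≥0, ∀ (T : ℝ) [Fact (0 < T)] (y : AddCircle T),
      ∫⁻ x : AddCircle T, ENNReal.ofReal ((1 + ‖x‖) ^ (-ρ) * (1 + ‖y - x‖) ^ (-ρ)) ≤
        C * ENNReal.ofReal ((1 + ‖y‖) ^ (-β)) := by
  have hI : ∫⁻ x : ℝ, ENNReal.ofReal ((1 + ‖x‖) ^ (-(2 * ρ - β))) < ∞ :=
    finite_integral_one_add_norm (by simpa using h)
  set I := ∫⁻ x : ℝ, ENNReal.ofReal ((1 + ‖x‖) ^ (-(2 * ρ - β))) with hIdef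
  have hIn : ENNReal.ofReal (2 ^ β) * (I + I) ≠ ∞ :=
    ENNReal.mul_ne_top ENNReal.ofReal_ne_top (ENNReal.add_ne_top.2 ⟨hI.ne, hI.ne⟩)
  refine ⟨(ENNReal.ofReal (2 ^ β) * (I + I)).toNNReal, fun T _ y => ?_⟩
  rw [ENNReal.coe_toNNReal hIn]
  have hpt : ∀ x : AddCircle T, ENNReal.ofReal ((1 + ‖x‖) ^ (-ρ) * (1 + ‖y - x‖) ^ (-ρ)) ≤
      ENNReal.ofReal (2 ^ β) * ENNReal.ofReal ((1 + ‖y‖) ^ (-β)) *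
        (ENNReal.ofReal ((1 + ‖x‖) ^ (-(2 * ρ - β))) +
          ENNReal.ofReal ((1 + ‖y - x‖) ^ (-(2 * ρ - β)))) := by
    intro x
    rw [← ENNReal.ofReal_add (by positivity) (by positivity),
      ← ENNReal.ofReal_mul (by positivity), ← ENNReal.ofReal_mul (by positivity)]
    refine ENNReal.ofReal_le_ofReal ?_
    refine (rpow_mul_rpow_le_of_le_add (c := 1 + ‖y‖) (by positivity) (by positivity)
      (by positivity) hβ hβρ ?_).trans_eq (by ring)
    have := norm_add_le x (y - x)
    rw [add_sub_cancel] at this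
    linarith
  have hm : Measurable fun x : AddCircle T => ENNReal.ofReal ((1 + ‖x‖) ^ (-(2 * ρ - β))) := by
    fun_prop
  refine (lintegral_mono hpt).trans ?_
  rw [lintegral_const_mul _ (by fun_prop), lintegral_add_left hm]
  have h1 := lintegral_one_add_norm_addCircle_le (2 * ρ - β) T
  have h2 : ∫⁻ x : AddCircle T, ENNReal.ofReal ((1 + ‖y - x‖) ^ (-(2 * ρ - β))) ≤ I := by
    rw [lintegral_sub_left_eq_self (fun x : AddCircle T =>
      ENNReal.ofReal ((1 + ‖x‖) ^ (-(2 * ρ - β)))) y]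
    exact h1
  calc _ ≤ ENNReal.ofReal (2 ^ β) * ENNReal.ofReal ((1 + ‖y‖) ^ (-β)) * (I + I) := by gcongr
    _ = _ := by ring

theorem exists_resonance_bound {s b : ℝ} (hs : 0 < s) (hb : max (1 / 4) (1 / 2 - s / 4) < b) :
    ∃ C : ℝ≥0, ∀ (τ : ℝ) [Fact (0 < τ)] (k : Freq) (σ : AddCircle (2 * π / τ))
      (S : Finset Freq), (∀ j ∈ S, j ∈ lowFreq τ ∧ k - j ∈ lowFreq τ) →
      ∑ j ∈ S, ∫⁻ x : AddCircle (2 * π / τ), ENNReal.ofReal (spaceBracket j ^ (-(2 * s)) *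
        ((1 + ‖x - (freqSq j : AddCircle (2 * π / τ))‖) ^ (-(2 * b)) *
          (1 + ‖σ - x - (freqSq (k - j) : AddCircle (2 * π / τ))‖) ^ (-(2 * b)))) ≤ C := by
  obtain ⟨hb1, hb2⟩ := max_lt_iff.1 hb
  -- The hypothesis on `b` is what makes room for `β`: `0 < 4b - 1` means `b > 1/4`, and `1 - s < 4b
  -- - 1` means `b > 1/2 - s/4`.
  obtain ⟨β, hβ, hβ'⟩ := exists_between
    (show max 0 (1 - s) < min (min (4 * b - 1) (2 * b)) 1 by
      refine max_lt (lt_min (lt_min ?_ ?_) ?_) (lt_min (lt_min ?_ ?_) ?_) <;> linarith)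
  obtain ⟨hβ0, hβs⟩ := max_lt_iff.1 hβ
  obtain ⟨⟨hβ1, hβ2⟩, hβ3⟩ : (β < 4 * b - 1 ∧ β < 2 * b) ∧ β < 1 := by
    simpa only [lt_min_iff] using hβ'
  obtain ⟨B, hB, hsum⟩ := exists_sum_weighted_resonance_le hβ0 hβ3 hβs
  obtain ⟨C, hC⟩ := exists_lintegral_mul_rpow_le (ρ := 2 * b) (β := β) hβ0.le hβ2.le (by linarith)
  refine ⟨C * B.toNNReal, fun τ _ k σ S hS => ?_⟩
  have hterm : ∀ j, ∫⁻ x : AddCircle (2 * π / τ), ENNReal.ofReal (spaceBracket j ^ (-(2 * s)) *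
        ((1 + ‖x - (freqSq j : AddCircle (2 * π / τ))‖) ^ (-(2 * b)) *
          (1 + ‖σ - x - (freqSq (k - j) : AddCircle (2 * π / τ))‖) ^ (-(2 * b)))) ≤
      C * ENNReal.ofReal (spaceBracket j ^ (-(2 * s)) *
        (1 + ‖σ - ((freqSq j + freqSq (k - j) : ℝ) : AddCircle (2 * π / τ))‖) ^ (-β)) := by
    intro j
    have hj : 0 ≤ spaceBracket j ^ (-(2 * s)) := Real.rpow_nonneg (Real.sqrt_nonneg _) _
    simp_rw [ENNReal.ofReal_mul hj]
    rw [lintegral_const_mul _ (by fun_prop)]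
    rw [← lintegral_add_right_eq_self _ (freqSq j : AddCircle (2 * π / τ))]
    have : ∀ x : AddCircle (2 * π / τ),
        σ - (x + (freqSq j : AddCircle (2 * π / τ))) - (freqSq (k - j) : AddCircle (2 * π / τ)) =
        (σ - ((freqSq j + freqSq (k - j) : ℝ) : AddCircle (2 * π / τ))) - x := by
      intro x; rw [AddCircle.coe_add]; abel
    simp_rw [this, add_sub_cancel_right]
    exact (mul_le_mul_right (hC _ _) _).trans_eq (mul_left_comm _ _ _)
  refine (Finset.sum_le_sum fun j _ => hterm j).trans ?_
  have hnn : ∀ j ∈ S, 0 ≤ spaceBracket j ^ (-(2 * s)) *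
      (1 + ‖σ - ((freqSq j + freqSq (k - j) : ℝ) : AddCircle (2 * π / τ))‖) ^ (-β) := fun j _ =>
    mul_nonneg (Real.rpow_nonneg (Real.sqrt_nonneg _) _) (by positivity)
  rw [← Finset.mul_sum, ← ENNReal.ofReal_sum_of_nonneg hnn]
  push_cast
  gcongr
  exact ENNReal.ofReal_le_ofReal (hsum τ k σ S hS)

/-- After reduction to `|y| ≤ π/τ`, Jordan's inequality gives `|d_τ(y)| = 2|sin(τy/2)|/τ ≥ 2|y|/π ≥
|y|/2`. This one direction serves both the exponent `b` on the inputs and `-b` on the output. -/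
theorem one_add_norm_le_bracket_dTau (τ : ℝ) [hτ : Fact (0 < τ)] (x : ℝ) :
    (1 + ‖(x : AddCircle (2 * π / τ))‖) / 4 ≤ bracket (dTau τ x) := by
  have hτ0 : 0 < τ := hτ.out
  have hT0 : 0 < 2 * π / τ := (factPeriod τ).out
  obtain ⟨y, hy, hxy⟩ : ∃ y ∈ Set.Ioc (-(π / τ)) (-(π / τ) + 2 * π / τ),
      (y : AddCircle (2 * π / τ)) = x := by
    obtain ⟨s, hs⟩ := (AddCircle.equivIoc (2 * π / τ) (-(π / τ))).symm.surjective x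
    exact ⟨s, s.2, hs⟩
  have habs : |y| ≤ π / τ := by
    rw [abs_le]; constructor
    · exact hy.1.le
    · calc y ≤ _ := hy.2
        _ = π / τ := by ring
  have hn : ‖(x : AddCircle (2 * π / τ))‖ = |y| := by
    rw [← hxy, AddCircle.norm_coe_eq_abs_iff _ hT0.ne', abs_of_pos hT0]
    calc |y| ≤ _ := habs
      _ = _ := by ring
  have hexp : dTau τ x = dTau τ y := by
    have : (x : AddCircle (2 * π / τ)) - y = 0 := by rw [hxy, sub_self]
    rw [← AddCircle.coe_sub, AddCircle.coe_eq_zero_iff] at this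
    obtain ⟨n, hn⟩ := this
    have hx : x = y + n * (2 * π / τ) := by
      rw [zsmul_eq_mul] at hn; linarith
    rw [dTau, dTau, hx]
    congr 2
    have : Complex.I * τ * ((y + n * (2 * π / τ) : ℝ) : ℂ) =
        Complex.I * τ * y + n * (2 * π * Complex.I) := by
      have : (τ : ℂ) ≠ 0 := by exact_mod_cast hτ0.ne'
      push_cast; field_simp
    rw [this, Complex.exp_add, Complex.exp_int_mul_two_pi_mul_I, mul_one]
  have hd : |y| / 2 ≤ ‖dTau τ y‖ := by
    have h1 : ‖dTau τ y‖ = 2 * |Real.sin (τ * y / 2)| / τ := by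
      rw [dTau, norm_div, Complex.norm_real, Real.norm_of_nonneg hτ0.le, mul_assoc,
        ← Complex.ofReal_mul, Complex.norm_exp_I_mul_ofReal_sub_one, norm_mul]
      simp
    have h2 : 2 / π * |τ * y / 2| ≤ |Real.sin (τ * y / 2)| := by
      refine Real.mul_abs_le_abs_sin ?_
      rw [abs_div, abs_mul, abs_of_pos hτ0, abs_two]
      have : τ * |y| ≤ π := by
        rw [le_div_iff₀ hτ0] at habs; linarith
      linarith
    rw [h1, le_div_iff₀ hτ0]
    rw [abs_div, abs_mul, abs_of_pos hτ0, abs_two] at h2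
    have h3 : (1 : ℝ) / 2 ≤ 2 / π := by
      rw [div_le_div_iff₀ (by norm_num) Real.pi_pos]; linarith [Real.pi_le_four]
    have h4 : 0 ≤ τ * |y| := by positivity
    nlinarith
  rw [hn, hexp, bracket]
  refine Real.le_sqrt_of_sq_le ?_
  nlinarith [abs_nonneg y, sq_nonneg (‖dTau τ y‖ - 1), norm_nonneg (dTau τ y)]

end Weights

/-! ### Convolutions of nonnegative functions on an abelian group -/

section ConvolutionAlgebra

/-- The `L²` norm of a nonnegative function. -/
def l2 {α : Type*} [MeasurableSpace α] (μ : Measure α) (f : α → ℝ≥0∞) : ℝ≥0∞ :=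
  (∫⁻ x, f x ^ 2 ∂μ) ^ (1 / 2 : ℝ)

theorem l2_sq {α : Type*} [MeasurableSpace α] (μ : Measure α) (f : α → ℝ≥0∞) :
    l2 μ f ^ 2 = ∫⁻ x, f x ^ 2 ∂μ := by
  rw [l2, ← ENNReal.rpow_natCast, ← ENNReal.rpow_mul]; norm_num

theorem lintegral_mul_le_l2 {α : Type*} [MeasurableSpace α] (μ : Measure α) {f g : α → ℝ≥0∞}
    (hf : Measurable f) (hg : Measurable g) :
    ∫⁻ x, f x * g x ∂μ ≤ l2 μ f * l2 μ g := by
  have := ENNReal.lintegral_mul_le_Lp_mul_Lq μ (p := 2) (q := 2)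
    (Real.holderConjugate_iff.2 (by norm_num)) hf.aemeasurable hg.aemeasurable
  simpa only [l2, ← ENNReal.rpow_natCast, Nat.cast_ofNat, Pi.mul_apply] using this

theorem l2_mono {α : Type*} [MeasurableSpace α] (μ : Measure α) {f g : α → ℝ≥0∞}
    (h : ∀ᵐ x ∂μ, f x ≤ g x) : l2 μ f ≤ l2 μ g := by
  unfold l2
  refine ENNReal.rpow_le_rpow (lintegral_mono_ae ?_) (by norm_num)
  filter_upwards [h] with x hx
  gcongr

variable {G : Type*} [MeasurableSpace G] [AddCommGroup G] {μ : Measure G}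

theorem lintegral_mul_eq_lconvolution (f g : G → ℝ≥0∞) :
    ∫⁻ x, f x * g x ∂μ = (f ⋆ₗ[μ] fun x => g (-x)) 0 := by
  simp [lconvolution_def]

theorem lconvolution_neg [MeasurableNeg G] [μ.IsNegInvariant] (f g : G → ℝ≥0∞) (x : G) :
    (f ⋆ₗ[μ] g) (-x) = ((fun x => f (-x)) ⋆ₗ[μ] fun x => g (-x)) x := by
  simp only [lconvolution_def]
  rw [← lintegral_neg_eq_self]
  simp [add_comm]

variable [MeasurableAdd₂ G] [MeasurableNeg G] [SFinite μ] [μ.IsAddLeftInvariant]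

theorem lintegral_lconvolution {f g : G → ℝ≥0∞} (hf : Measurable f) (hg : Measurable g) :
    ∫⁻ x, (f ⋆ₗ[μ] g) x ∂μ = (∫⁻ x, f x ∂μ) * ∫⁻ x, g x ∂μ := by
  simp only [lconvolution_def]
  rw [lintegral_lintegral_swap (by fun_prop)]
  have : ∀ y, ∫⁻ x, f y * g (-y + x) ∂μ = f y * ∫⁻ x, g x ∂μ := fun y => by
    rw [lintegral_const_mul _ (by fun_prop), lintegral_add_left_eq_self]
  simp_rw [this]
  rw [lintegral_mul_const _ hf]

/-- Cauchy–Schwarz inside the convolution separates the weights, bounded pointwise by `M`, from `f²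
⋆ g²`, whose integral factors by Tonelli. -/
theorem l2_lconvolution_le {v₁ v₂ f g : G → ℝ≥0∞} (hv₁ : Measurable v₁) (hv₂ : Measurable v₂)
    (hf : Measurable f) (hg : Measurable g) {M : ℝ≥0}
    (hM : ∀ x, ((fun x => v₁ x ^ 2) ⋆ₗ[μ] fun x => v₂ x ^ 2) x ≤ M) :
    l2 μ ((fun x => v₁ x * f x) ⋆ₗ[μ] fun x => v₂ x * g x) ≤
      (NNReal.sqrt M : ℝ≥0) * (l2 μ f * l2 μ g) := by
  have hpt : ∀ x, ((fun x => v₁ x * f x) ⋆ₗ[μ] fun x => v₂ x * g x) x ^ 2 ≤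
      M * ((fun x => f x ^ 2) ⋆ₗ[μ] fun x => g x ^ 2) x := by
    intro x
    have h := lintegral_mul_le_l2 μ (f := fun y => v₁ y * v₂ (-y + x))
      (g := fun y => f y * g (-y + x)) (by fun_prop) (by fun_prop)
    have h2 : ((fun x => v₁ x * f x) ⋆ₗ[μ] fun x => v₂ x * g x) x =
        ∫⁻ y, v₁ y * v₂ (-y + x) * (f y * g (-y + x)) ∂μ := by
      rw [lconvolution_def]
      exact lintegral_congr fun y => by ring
    rw [h2]
    calc _ ≤ (l2 μ (fun y => v₁ y * v₂ (-y + x)) * l2 μ (fun y => f y * g (-y + x))) ^ 2 := by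
          gcongr
      _ = ((fun x => v₁ x ^ 2) ⋆ₗ[μ] fun x => v₂ x ^ 2) x *
          ((fun x => f x ^ 2) ⋆ₗ[μ] fun x => g x ^ 2) x := by
          rw [mul_pow, l2_sq, l2_sq, lconvolution_def, lconvolution_def]
          simp_rw [mul_pow]
      _ ≤ _ := by gcongr; exact hM x
  have hint : ∫⁻ x, ((fun x => v₁ x * f x) ⋆ₗ[μ] fun x => v₂ x * g x) x ^ 2 ∂μ ≤
      M * ((∫⁻ x, f x ^ 2 ∂μ) * ∫⁻ x, g x ^ 2 ∂μ) := by
    refine (lintegral_mono hpt).trans_eq ?_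
    rw [lintegral_const_mul _ (by fun_prop), lintegral_lconvolution (by fun_prop) (by fun_prop)]
  rw [l2]
  refine (ENNReal.rpow_le_rpow hint (by norm_num)).trans_eq ?_
  rw [ENNReal.mul_rpow_of_nonneg _ _ (by norm_num), ENNReal.mul_rpow_of_nonneg _ _ (by norm_num),
    l2, l2, NNReal.sqrt_eq_rpow, ENNReal.coe_rpow_of_nonneg _ (by norm_num)]

variable [μ.IsNegInvariant]

theorem lconvolution_lconvolution_comm {a b c d : G → ℝ≥0∞} (ha : Measurable a) (hb : Measurable b)
    (hc : Measurable c) (hd : Measurable d) :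
    (a ⋆ₗ[μ] b) ⋆ₗ[μ] (c ⋆ₗ[μ] d) = (a ⋆ₗ[μ] c) ⋆ₗ[μ] (b ⋆ₗ[μ] d) := by
  rw [← lconvolution_assoc ha hb (by fun_prop), ← lconvolution_assoc ha hc (by fun_prop),
    lconvolution_assoc hb hc hd, lconvolution_assoc hc hb hd,
    lconvolution_comm (f := b) (g := c)]

/-- Both squared norms are the value at `0` of the same fourfold convolution of `f`, `g` and their
reflections. -/
theorem l2_lconvolution_neg {f g : G → ℝ≥0∞} (hf : Measurable f) (hg : Measurable g) :
    l2 μ (f ⋆ₗ[μ] fun x => g (-x)) = l2 μ (f ⋆ₗ[μ] g) := by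
  have hf' : Measurable fun x => f (-x) := by fun_prop
  have hg' : Measurable fun x => g (-x) := by fun_prop
  unfold l2
  congr 1
  simp_rw [sq]
  rw [lintegral_mul_eq_lconvolution, lintegral_mul_eq_lconvolution]
  simp_rw [lconvolution_neg, neg_neg]
  have e : ∀ f g : G → ℝ≥0∞, (fun x => (f ⋆ₗ[μ] g) x) = f ⋆ₗ[μ] g := fun _ _ => rfl
  rw [e, e, lconvolution_comm (f := fun x => f (-x)) (g := g),
    lconvolution_lconvolution_comm hf hg' hg hf',
    lconvolution_comm (f := fun x => f (-x)) (g := fun x => g (-x))]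

/-- Moving the reflected factor across, the integral equals that of `(f₁ ⋆ f₃) (f₂ ⋆ v)`. -/
theorem lintegral_trilinear_le {f₁ f₂ f₃ v : G → ℝ≥0∞} (h₁ : Measurable f₁) (h₂ : Measurable f₂)
    (h₃ : Measurable f₃) (hv : Measurable v) :
    ∫⁻ x, ((f₁ ⋆ₗ[μ] f₃) ⋆ₗ[μ] fun x => f₂ (-x)) x * v x ∂μ ≤
      l2 μ (f₁ ⋆ₗ[μ] f₃) * l2 μ (f₂ ⋆ₗ[μ] v) := by
  have h₂' : Measurable fun x => f₂ (-x) := by fun_prop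
  have hv' : Measurable fun x => v (-x) := by fun_prop
  rw [lintegral_mul_eq_lconvolution, ← lconvolution_assoc (by fun_prop) h₂' hv']
  refine le_trans (le_of_eq ?_) (lintegral_mul_le_l2 μ (by fun_prop) (by fun_prop))
  rw [lintegral_mul_eq_lconvolution]
  simp_rw [lconvolution_neg]

/-- The other grouping: the fourfold convolution at `0` pairs `f₁` with the reflected `f₂` and `v`
with the reflected `f₃`; the reflections then drop out of the norms. -/
theorem lintegral_trilinear_le' {f₁ f₂ f₃ v : G → ℝ≥0∞} (h₁ : Measurable f₁) (h₂ : Measurable f₂)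
    (h₃ : Measurable f₃) (hv : Measurable v) :
    ∫⁻ x, ((f₁ ⋆ₗ[μ] f₃) ⋆ₗ[μ] fun x => f₂ (-x)) x * v x ∂μ ≤
      l2 μ (f₁ ⋆ₗ[μ] f₂) * l2 μ (v ⋆ₗ[μ] f₃) := by
  have h₂' : Measurable fun x => f₂ (-x) := by fun_prop
  have h₃' : Measurable fun x => f₃ (-x) := by fun_prop
  have hv' : Measurable fun x => v (-x) := by fun_prop
  rw [lintegral_mul_eq_lconvolution, ← lconvolution_assoc (by fun_prop) h₂' hv',
    lconvolution_lconvolution_comm h₁ h₃ h₂' hv', ← l2_lconvolution_neg h₁ h₂,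
    ← l2_lconvolution_neg hv h₃, lconvolution_comm (f := v)]
  refine le_trans (le_of_eq ?_) (lintegral_mul_le_l2 μ (by fun_prop) (by fun_prop))
  rw [lintegral_mul_eq_lconvolution]
  simp_rw [lconvolution_neg, neg_neg]

end ConvolutionAlgebra

/-! ### Phase space and the bilinear estimate -/

section PhaseSpace

/-- Space-time frequencies `(k, σ)`, the time frequency being taken modulo `2π / τ`. -/
abbrev Phase (τ : ℝ) : Type := Freq × AddCircle (2 * π / τ)

/-- Counting measure in `k` times Lebesgue measure in `σ`. -/
def phaseMeasure (τ : ℝ) [Fact (0 < τ)] : Measure (Phase τ) := Measure.count.prod volume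

instance (τ : ℝ) [Fact (0 < τ)] : SFinite (phaseMeasure τ) := by
  unfold phaseMeasure; infer_instance

instance (τ : ℝ) [Fact (0 < τ)] : (phaseMeasure τ).IsAddLeftInvariant := by
  unfold phaseMeasure; infer_instance

instance (τ : ℝ) [Fact (0 < τ)] : (phaseMeasure τ).IsNegInvariant where
  neg_eq_self := by
    have h : (Neg.neg : Phase τ → Phase τ) = Prod.map Neg.neg Neg.neg := rfl
    rw [Measure.neg, phaseMeasure, h, ← Measure.map_prod_map _ _ measurable_neg measurable_neg,
      Measure.map_neg_eq_self, Measure.map_neg_eq_self]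

theorem lintegral_phaseMeasure (τ : ℝ) [Fact (0 < τ)] {f : Phase τ → ℝ≥0∞} (hf : Measurable f) :
    ∫⁻ p, f p ∂phaseMeasure τ = ∑' k, ∫⁻ σ, f (k, σ) := by
  rw [phaseMeasure, lintegral_prod _ hf.aemeasurable, lintegral_count]

/-- `1 + dist(σ - |k|², (2π / τ) ℤ)`. -/
def modulation (τ : ℝ) (p : Phase τ) : ℝ := 1 + ‖p.2 - (freqSq p.1 : AddCircle (2 * π / τ))‖

/-- The weight `⟨k⟩^s (1 + dist(σ - |k|², (2π / τ) ℤ))^b`. -/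
def weight (τ s b : ℝ) (p : Phase τ) : ℝ≥0∞ :=
  ENNReal.ofReal (spaceBracket p.1 ^ s * modulation τ p ^ b)

theorem measurable_phase {τ : ℝ} {f : Phase τ → ℝ≥0∞} (hf : ∀ k, Measurable fun σ => f (k, σ)) :
    Measurable f := measurable_from_prod_countable_right hf

@[fun_prop]
theorem measurable_weight (τ s b : ℝ) : Measurable (weight τ s b) := by
  refine measurable_phase fun k => ?_
  unfold weight modulation
  fun_prop

theorem modulation_pos (τ : ℝ) (p : Phase τ) : 0 < modulation τ p := by
  unfold modulation; positivity

theorem weight_mul_weight (τ s b s' b' : ℝ) (p : Phase τ) :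
    weight τ s b p * weight τ s' b' p = weight τ (s + s') (b + b') p := by
  have h1 : 0 < spaceBracket p.1 := zero_lt_one.trans_le (one_le_spaceBracket _)
  have h2 := modulation_pos τ p
  rw [weight, weight, weight, ← ENNReal.ofReal_mul (by positivity), Real.rpow_add h1,
    Real.rpow_add h2]
  congr 1; ring

theorem weight_zero (τ : ℝ) (p : Phase τ) : weight τ 0 0 p = 1 := by simp [weight]

/-- A function on phase space which vanishes off the filtered frequencies. -/
def LowSupported (τ : ℝ) (f : Phase τ → ℝ≥0∞) : Prop := ∀ p, p.1 ∉ lowFreq τ → f p = 0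

/-- The bracket weight falls on `f` alone. This asymmetry is what later lets one input and the test
function go without it. -/
theorem exists_l2_lconvolution_le {s b : ℝ} (hs : 0 < s) (hb : max (1 / 4) (1 / 2 - s / 4) < b) :
    ∃ C : ℝ≥0, ∀ (τ : ℝ) [Fact (0 < τ)] (f g : Phase τ → ℝ≥0∞), Measurable f → Measurable g →
      LowSupported τ f → LowSupported τ g →
      l2 (phaseMeasure τ) (f ⋆ₗ[phaseMeasure τ] g) ≤
        C * (l2 (phaseMeasure τ) (fun p => weight τ s b p * f p) *
          l2 (phaseMeasure τ) (fun p => weight τ 0 b p * g p)) := by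
  obtain ⟨M, hM⟩ := exists_resonance_bound hs hb
  refine ⟨NNReal.sqrt M, fun τ _ f g hf hg hfs hgs => ?_⟩
  classical
  -- The cut-off costs nothing on functions supported in the filter, and it restricts the resonance
  -- sum to `j` with both `j` and `k - j` filtered.
  let χ : Phase τ → ℝ≥0∞ := fun p => if p.1 ∈ lowFreq τ then 1 else 0
  have hχ : Measurable χ := by
    refine measurable_phase fun k => ?_
    by_cases h : k ∈ lowFreq τ <;> simp [χ, h]
  have hcancel : ∀ (s : ℝ) (f : Phase τ → ℝ≥0∞), LowSupported τ f →
      f = fun p => (χ p * weight τ (-s) (-b) p) * (weight τ s b p * f p) := by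
    intro s f hf
    ext p
    by_cases hp : p.1 ∈ lowFreq τ
    · simp only [χ, hp, if_true, one_mul]
      rw [← mul_assoc, weight_mul_weight]; simp [weight_zero]
    · simp [hf p hp]
  have hbound : ∀ p, ((fun p => (χ p * weight τ (-s) (-b) p) ^ 2) ⋆ₗ[phaseMeasure τ]
      fun p => (χ p * weight τ (-0) (-b) p) ^ 2) p ≤ M := by
    rintro ⟨k, σ⟩
    rw [lconvolution_def, lintegral_phaseMeasure τ (by fun_prop)]
    rw [tsum_eq_sum (s := (lowFreq τ).filter fun j => k - j ∈ lowFreq τ)]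
    · refine le_trans (Finset.sum_le_sum fun j hj => ?_)
        (hM τ k σ ((lowFreq τ).filter fun j => k - j ∈ lowFreq τ) fun j hj => by simpa using hj)
      refine lintegral_mono fun x => ?_
      have hj' := Finset.mem_filter.1 hj
      have h0 : 0 < spaceBracket j := zero_lt_one.trans_le (one_le_spaceBracket _)
      have h0' : 0 < spaceBracket (k - j) := zero_lt_one.trans_le (one_le_spaceBracket _)
      have h1 : -j + k = k - j := by abel
      have h2 : -x + σ = σ - x := by abel
      simp only [χ, Prod.mk_add_mk, Prod.neg_mk, h1, h2, hj'.1, hj'.2, if_true, one_mul, weight,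
        modulation]
      rw [← ENNReal.ofReal_pow (by positivity), ← ENNReal.ofReal_pow (by positivity),
        ← ENNReal.ofReal_mul (by positivity)]
      refine le_of_eq (congrArg _ ?_)
      have sqr : ∀ (y e : ℝ), 0 < y → y ^ (-(2 * e)) = (y ^ (-e)) ^ 2 := fun y e hy => by
        rw [← Real.rpow_natCast, ← Real.rpow_mul hy.le]; congr 1; push_cast; ring
      rw [sqr _ s h0, sqr _ b (by positivity), sqr _ b (by positivity), neg_zero, Real.rpow_zero]
      ring
    · intro j hj
      simp only [Finset.mem_filter, not_and_or] at hj
      have h1 : -j + k = k - j := by abel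
      rcases hj with hj | hj <;> simp [χ, hj, h1]
  have := l2_lconvolution_le (μ := phaseMeasure τ) (v₁ := fun p => χ p * weight τ (-s) (-b) p)
    (v₂ := fun p => χ p * weight τ (-0) (-b) p) (f := fun p => weight τ s b p * f p)
    (g := fun p => weight τ 0 b p * g p) (by fun_prop) (by fun_prop) (by fun_prop) (by fun_prop)
    hbound
  rwa [← hcancel s f hfs, ← hcancel 0 g hgs] at this

end PhaseSpace

/-! ### Discrete Fourier transform in time: products, conjugates, Parseval -/

section TimeFourier

open AddCircle

theorem memℓp_two_iff {c : ℤ → ℂ} : Memℓp c 2 ↔ Summable fun n => ‖c n‖ ^ 2 := by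
  rw [memℓp_gen_iff (by norm_num)]
  simp

theorem memℓp_two_mul {c d : ℤ → ℂ} (hc : Memℓp c 2) (hd : Memℓp d 2) :
    Memℓp (fun n => c n * d n) 2 := by
  rw [memℓp_two_iff] at *
  refine Summable.of_nonneg_of_le (fun n => by positivity) (fun n => ?_) (hc.mul_right (∑' n, ‖d n‖ ^ 2))
  rw [norm_mul, mul_pow]
  exact mul_le_mul_of_nonneg_left (hd.le_tsum n fun _ _ => by positivity) (by positivity)

theorem memℓp_two_conj {c : ℤ → ℂ} (hc : Memℓp c 2) : Memℓp (fun n => (starRingEnd ℂ) (c n)) 2 := by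
  rw [memℓp_two_iff] at *
  simpa using hc

variable {T : ℝ} [hT : Fact (0 < T)]

theorem volume_addCircle_eq : (volume : Measure (AddCircle T)) = ENNReal.ofReal T • haarAddCircle :=
  AddCircle.volume_eq_smul_haarAddCircle

theorem volume_ac_haarAddCircle : (volume : Measure (AddCircle T)) ≪ haarAddCircle := by
  rw [volume_addCircle_eq]
  exact Measure.smul_absolutelyContinuous

theorem lintegral_volume_eq (f : AddCircle T → ℝ≥0∞) :
    ∫⁻ x, f x = ENNReal.ofReal T * ∫⁻ x, f x ∂haarAddCircle := by
  rw [volume_addCircle_eq, lintegral_smul_measure, smul_eq_mul]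

theorem fourierCoeff_convolution {A B : AddCircle T → ℂ} (hA : Integrable A haarAddCircle)
    (hB : Integrable B haarAddCircle) (n : ℤ) :
    fourierCoeff (fun x => ∫ t, A t * B (x - t) ∂haarAddCircle) n =
      fourierCoeff A n * fourierCoeff B n := by
  have h := integral_convolution (ContinuousLinearMap.mul ℂ ℂ) (hA.fourier_smul (-n))
    (hB.fourier_smul (-n))
  simp only [ContinuousLinearMap.mul_apply'] at h
  rw [fourierCoeff, fourierCoeff, fourierCoeff, ← h]
  refine integral_congr_ae (Filter.Eventually.of_forall fun x => ?_)
  simp only [convolution_def, ContinuousLinearMap.mul_apply', smul_eq_mul]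
  rw [← integral_const_mul]
  refine integral_congr_ae (Filter.Eventually.of_forall fun t => ?_)
  have : (fourier (-n) x : ℂ) = fourier (-n) t * fourier (-n) (x - t) := by
    simp only [fourier_apply]
    rw [← Circle.coe_mul, ← AddCircle.toCircle_add, ← smul_add, add_sub_cancel]
  simp only [this]; ring

theorem l2_lt_top_of_memLp {A : AddCircle T → ℂ} (hA : MemLp A 2 haarAddCircle) :
    l2 haarAddCircle (fun x => ‖A x‖ₑ) < ∞ := by
  have := hA.eLpNorm_lt_top
  rw [eLpNorm_eq_lintegral_rpow_enorm_toReal (by norm_num) (by norm_num)] at this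
  simpa [l2] using this

theorem memLp_convolution {A B : AddCircle T → ℂ} (hAm : StronglyMeasurable A)
    (hBm : StronglyMeasurable B) (hA : MemLp A 2 haarAddCircle) (hB : MemLp B 2 haarAddCircle) :
    MemLp (fun x => ∫ t, A t * B (x - t) ∂haarAddCircle) 2 haarAddCircle := by
  have hmeas : AEStronglyMeasurable (fun x => ∫ t, A t * B (x - t) ∂haarAddCircle) haarAddCircle :=
    ((hA.integrable (by norm_num)).integrable_convolution (ContinuousLinearMap.mul ℂ ℂ)
      (hB.integrable (by norm_num))).aestronglyMeasurable
  have hb := ENNReal.mul_lt_top (l2_lt_top_of_memLp hA) (l2_lt_top_of_memLp hB)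
  refine MemLp.of_bound hmeas
    (l2 haarAddCircle (fun x => ‖A x‖ₑ) * l2 haarAddCircle (fun x => ‖B x‖ₑ)).toReal
    (Filter.Eventually.of_forall fun x => ?_)
  rw [← toReal_enorm]
  refine ENNReal.toReal_mono hb.ne ?_
  refine (enorm_integral_le_lintegral_enorm _).trans ?_
  simp_rw [enorm_mul]
  refine (lintegral_mul_le_l2 _ (by fun_prop) ?_).trans_eq ?_
  · exact (hBm.measurable.comp (by fun_prop)).enorm
  · congr 1
    unfold l2
    rw [lintegral_sub_left_eq_self (fun t : AddCircle T => ‖B t‖ₑ ^ 2) x]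

theorem fourierCoeff_conj_neg (A : AddCircle T → ℂ) (n : ℤ) :
    fourierCoeff (fun x => (starRingEnd ℂ) (A (-x))) n = (starRingEnd ℂ) (fourierCoeff A n) := by
  rw [fourierCoeff, fourierCoeff, ← integral_conj, ← integral_neg_eq_self]
  refine integral_congr_ae (Filter.Eventually.of_forall fun x => ?_)
  simp [fourier_apply]

variable {τ : ℝ} [hτ : Fact (0 < τ)]

theorem fourierCoeff_timeFT {c : ℤ → ℂ} (hc : Memℓp c 2) (n : ℤ) :
    fourierCoeff (timeFT τ c) n = τ * c n := by
  have hm : Memℓp (fun n => (τ : ℂ) * c n) 2 := hc.const_mul (τ : ℂ)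
  let f : lp (fun _ : ℤ => ℂ) 2 := ⟨_, hm⟩
  have h := (fourierBasis (T := 2 * π / τ)).hasSum_repr_symm f
  have h2 : timeFT τ c = (fourierBasis (T := 2 * π / τ)).repr.symm f := by
    rw [← h.tsum_eq, timeFT]
    simp [f, coe_fourierBasis]
  rw [h2, ← fourierBasis_repr, LinearIsometryEquiv.apply_symm_apply]

/-- Uniqueness of Fourier coefficients in `L²` identifies the transforms of products and conjugates
with explicit functions. -/
theorem timeFT_ae_eq {c : ℤ → ℂ} {g : AddCircle (2 * π / τ) → ℂ} (hg : MemLp g 2 haarAddCircle)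
    (h : ∀ n, fourierCoeff g n = τ * c n) : timeFT τ c =ᵐ[haarAddCircle] g := by
  have h1 := (hasSum_fourier_series_L2 (hg.toLp g)).tsum_eq
  have h2 : timeFT τ c = hg.toLp g := by
    rw [← h1, timeFT]
    congr 1
    ext1 n
    rw [fourierCoeff_congr_ae hg.coeFn_toLp, h]
  rw [h2]
  exact hg.coeFn_toLp

theorem memLp_timeFT (c : ℤ → ℂ) : MemLp (timeFT τ c) 2 haarAddCircle := Lp.memLp _

theorem stronglyMeasurable_timeFT (c : ℤ → ℂ) : StronglyMeasurable (timeFT τ c) :=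
  Lp.stronglyMeasurable _

/-- A product in time becomes `1/τ` times a convolution for normalised Haar measure. Lebesgue
measure is `2π/τ` times Haar measure, and `1/τ ≤ 2π/τ`. -/
theorem enorm_timeFT_sum_mul_le {ι : Type*} (S : Finset ι) {c d : ι → ℤ → ℂ}
    (hc : ∀ i, Memℓp (c i) 2) (hd : ∀ i, Memℓp (d i) 2) :
    ∀ᵐ σ : AddCircle (2 * π / τ), ‖timeFT τ (fun n => ∑ i ∈ S, c i n * d i n) σ‖ₑ ≤
      ∑ i ∈ S, ∫⁻ x, ‖timeFT τ (c i) x‖ₑ * ‖timeFT τ (d i) (-x + σ)‖ₑ := by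
  have hτ0 : 0 < τ := hτ.out
  let g : ι → AddCircle (2 * π / τ) → ℂ := fun i x =>
    ∫ t, timeFT τ (c i) t * timeFT τ (d i) (x - t) ∂haarAddCircle
  have hg : ∀ i, MemLp (g i) 2 haarAddCircle := fun i =>
    memLp_convolution (stronglyMeasurable_timeFT _) (stronglyMeasurable_timeFT _)
      (memLp_timeFT _) (memLp_timeFT _)
  have hgc : ∀ i n, fourierCoeff (g i) n = (τ * c i n) * (τ * d i n) := fun i n => by
    rw [fourierCoeff_convolution ((memLp_timeFT _).integrable (by norm_num))
      ((memLp_timeFT _).integrable (by norm_num)), fourierCoeff_timeFT (hc i),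
      fourierCoeff_timeFT (hd i)]
  have hG : timeFT τ (fun n => ∑ i ∈ S, c i n * d i n) =ᵐ[haarAddCircle]
      fun x => (τ : ℂ)⁻¹ * (∑ i ∈ S, g i) x := by
    refine timeFT_ae_eq ((memLp_finsetSum' S fun i _ => hg i).const_mul _) fun n => ?_
    have hsum : fourierCoeff (∑ i ∈ S, g i) n = ∑ i ∈ S, fourierCoeff (g i) n := by
      rw [fourierCoeff.sum S g fun i _ => (hg i).integrable (by norm_num)]
      simp
    rw [fourierCoeff.const_mul, hsum, Finset.mul_sum, Finset.mul_sum]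
    refine Finset.sum_congr rfl fun i _ => ?_
    have : (τ : ℂ) ≠ 0 := by exact_mod_cast hτ0.ne'
    rw [hgc]; field_simp
  filter_upwards [volume_ac_haarAddCircle.ae_le hG] with σ hσ
  rw [hσ, Finset.sum_apply, Finset.mul_sum]
  refine (enorm_sum_le _ _).trans (Finset.sum_le_sum fun i _ => ?_)
  rw [enorm_mul, lintegral_volume_eq]
  have h1 : ‖(τ : ℂ)⁻¹‖ₑ ≤ ENNReal.ofReal (2 * π / τ) := by
    rw [← ofReal_norm, norm_inv, Complex.norm_real, Real.norm_of_nonneg hτ0.le]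
    refine ENNReal.ofReal_le_ofReal ?_
    rw [inv_eq_one_div]
    gcongr
    linarith [Real.pi_gt_three]
  refine mul_le_mul' h1 ((enorm_integral_le_lintegral_enorm _).trans_eq ?_)
  simp_rw [enorm_mul, neg_add_eq_sub]

theorem enorm_timeFT_conj {c : ℤ → ℂ} (hc : Memℓp c 2) :
    ∀ᵐ σ : AddCircle (2 * π / τ), ‖timeFT τ (fun n => (starRingEnd ℂ) (c n)) σ‖ₑ =
      ‖timeFT τ c (-σ)‖ₑ := by
  have h : timeFT τ (fun n => (starRingEnd ℂ) (c n)) =ᵐ[haarAddCircle]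
      fun x => (starRingEnd ℂ) (timeFT τ c (-x)) := by
    refine timeFT_ae_eq ?_ fun n => ?_
    · exact ((memLp_timeFT (τ := τ) c).comp_measurePreserving
        (Measure.measurePreserving_neg haarAddCircle)).star
    · rw [fourierCoeff_conj_neg, fourierCoeff_timeFT hc]; simp
  filter_upwards [volume_ac_haarAddCircle.ae_le h] with σ hσ
  rw [hσ]
  rw [← ofReal_norm, ← ofReal_norm, RCLike.norm_conj]

/-- Parseval gives `2πτ` in place of `τ`; the factor `2π ≥ 1` is discarded. -/
theorem tsum_enorm_sq_le_lintegral_timeFT {c : ℤ → ℂ} (hc : Memℓp c 2) :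
    ENNReal.ofReal τ * ∑' n, ‖c n‖ₑ ^ 2 ≤ ∫⁻ σ, ‖timeFT τ c σ‖ₑ ^ 2 := by
  have hτ0 : 0 < τ := hτ.out
  have h := hasSum_sq_fourierCoeff (timeFT τ c)
  simp only [fourierCoeff_timeFT hc] at h
  have e1 : ∀ z : ℂ, ENNReal.ofReal (‖z‖ ^ 2) = ‖z‖ₑ ^ 2 := fun z => by
    rw [ENNReal.ofReal_pow (norm_nonneg _), ofReal_norm]
  have h2 : ∑' n, ‖(τ : ℂ) * c n‖ₑ ^ 2 = ∫⁻ σ, ‖timeFT τ c σ‖ₑ ^ 2 ∂haarAddCircle := by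
    simp_rw [← e1]
    rw [← ENNReal.ofReal_tsum_of_nonneg (fun _ => by positivity) h.summable, h.tsum_eq,
      ofReal_integral_eq_lintegral_ofReal (memLp_timeFT c).integrable_norm_pow'
        (Filter.Eventually.of_forall fun _ => by positivity)]
  rw [lintegral_volume_eq, ← h2]
  have h3 : ∀ n, ‖(τ : ℂ) * c n‖ₑ ^ 2 = ENNReal.ofReal (τ ^ 2) * ‖c n‖ₑ ^ 2 := fun n => by
    rw [enorm_mul, mul_pow, ← e1 (τ : ℂ), Complex.norm_real, Real.norm_of_nonneg hτ0.le]
  simp_rw [h3]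
  rw [ENNReal.tsum_mul_left, ← mul_assoc, ← ENNReal.ofReal_mul (by positivity)]
  gcongr
  have : 2 * π / τ * τ ^ 2 = 2 * π * τ := by field_simp
  rw [this]
  nlinarith [Real.pi_gt_three]

theorem lintegral_timeFT_lt_top (c : ℤ → ℂ) : ∫⁻ σ, ‖timeFT τ c σ‖ₑ ^ 2 < ∞ := by
  rw [lintegral_volume_eq, ← l2_sq]
  exact ENNReal.mul_lt_top ENNReal.ofReal_lt_top
    (ENNReal.pow_lt_top (l2_lt_top_of_memLp (memLp_timeFT c)))

end TimeFourier

/-! ### Trigonometric polynomials on the torus -/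

section TrigPoly

@[fun_prop]
theorem continuous_character (k : Freq) : Continuous (character k) := by
  unfold character
  fun_prop

theorem character_add (k l : Freq) (x : Torus) :
    character (k + l) x = character k x * character l x := by
  simp only [character, Pi.add_apply, fourier_add, Finset.prod_mul_distrib]

theorem character_neg (k : Freq) (x : Torus) :
    character (-k) x = (starRingEnd ℂ) (character k x) := by
  simp only [character, Pi.neg_apply, fourier_neg, map_prod]

theorem character_sub (k l : Freq) (x : Torus) :
    character (k - l) x = character k x * (starRingEnd ℂ) (character l x) := by
  rw [sub_eq_add_neg, character_add, character_neg]

theorem norm_character (k : Freq) (x : Torus) : ‖character k x‖ = 1 := by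
  rw [character, norm_prod]
  simp [fourier_apply, Circle.norm_coe]

theorem integral_mul_conj_character (f : Torus → ℂ) (k : Freq) :
    ∫ x, f x * (starRingEnd ℂ) (character k x) = 4 * (π : ℂ) ^ 2 * coeff f k := by
  have hpi : (π : ℂ) ≠ 0 := by exact_mod_cast Real.pi_ne_zero
  rw [coeff]
  field_simp

theorem integral_fourier (n : ℤ) :
    ∫ x : AddCircle (2 * π), (fourier n x : ℂ) = if n = 0 then (2 * π : ℂ) else 0 := by
  have h := congrFun (fourierCoeff_fourier (T := 2 * π) n) 0
  rw [fourierCoeff] at h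
  simp only [neg_zero, fourier_zero, one_smul] at h
  rw [AddCircle.volume_eq_smul_haarAddCircle, integral_smul_measure, h,
    ENNReal.toReal_ofReal Real.two_pi_pos.le]
  rcases eq_or_ne n 0 with rfl | hn
  · simp
  · simp [hn, hn.symm]

theorem integral_character (k : Freq) :
    ∫ x, character k x = if k = 0 then 4 * (π : ℂ) ^ 2 else 0 := by
  unfold character
  rw [integral_fintype_prod_volume_eq_prod (fun i (x : AddCircle (2 * π)) => (fourier (k i) x : ℂ))]
  simp_rw [integral_fourier]
  rw [Fin.prod_univ_two]
  by_cases h0 : k 0 = 0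
  · by_cases h1 : k 1 = 0
    · have : k = 0 := by ext i; fin_cases i <;> simp [h0, h1]
      simp [this]; ring
    · have : k ≠ 0 := fun h => h1 (by simp [h])
      simp [h1, this]
  · have : k ≠ 0 := fun h => h0 (by simp [h])
    simp [h0, this]

theorem memLp_of_continuous {f : Torus → ℂ} (hf : Continuous f) (p : ℝ≥0∞) : MemLp f p :=
  hf.memLp_of_hasCompactSupport (HasCompactSupport.of_compactSpace f)

theorem integrable_of_continuous {f : Torus → ℂ} (hf : Continuous f) : Integrable f :=
  memLp_one_iff_integrable.1 (memLp_of_continuous hf 1)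

theorem coeff_sum_character (S : Finset Freq) (a : Freq → ℂ) (k : Freq) :
    coeff (fun x => ∑ j ∈ S, a j * character j x) k = if k ∈ S then a k else 0 := by
  have h : ∀ x, (∑ j ∈ S, a j * character j x) * (starRingEnd ℂ) (character k x) =
      ∑ j ∈ S, a j * character (j - k) x := fun x => by
    rw [Finset.sum_mul]
    exact Finset.sum_congr rfl fun j _ => by rw [character_sub]; ring
  simp_rw [coeff, h]
  rw [integral_finsetSum _ fun j _ => integrable_of_continuous (by fun_prop)]
  simp_rw [integral_const_mul, integral_character, sub_eq_zero]
  have hpi : (π : ℂ) ≠ 0 := by exact_mod_cast Real.pi_ne_zero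
  by_cases hk : k ∈ S
  · simp [hk]; field_simp
  · simp [hk]

/-- Trigonometric polynomials with frequencies in `S`. -/
def IsTrigPoly (S : Finset Freq) (f : Torus → ℂ) : Prop :=
  ∃ a : Freq → ℂ, f = fun x => ∑ k ∈ S, a k * character k x

namespace IsTrigPoly

variable {S S' : Finset Freq} {f g : Torus → ℂ}

theorem coeff_eq_zero (hf : IsTrigPoly S f) {k : Freq} (hk : k ∉ S) : coeff f k = 0 := by
  obtain ⟨a, rfl⟩ := hf
  rw [coeff_sum_character, if_neg hk]

theorem eq_sum (hf : IsTrigPoly S f) (x : Torus) : f x = ∑ k ∈ S, coeff f k * character k x := by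
  obtain ⟨a, rfl⟩ := hf
  refine Finset.sum_congr rfl fun k hk => ?_
  rw [coeff_sum_character, if_pos hk]

theorem continuous (hf : IsTrigPoly S f) : Continuous f := by
  obtain ⟨a, rfl⟩ := hf
  fun_prop

theorem coeff_mul (hf : IsTrigPoly S f) (hg : Integrable g) (k : Freq) :
    coeff (fun x => f x * g x) k = ∑ j ∈ S, coeff f j * coeff g (k - j) := by
  have h : ∀ x, f x * g x * (starRingEnd ℂ) (character k x) =
      ∑ j ∈ S, coeff f j * (g x * (starRingEnd ℂ) (character (k - j) x)) := fun x => by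
    rw [hf.eq_sum x, Finset.sum_mul, Finset.sum_mul]
    refine Finset.sum_congr rfl fun j _ => ?_
    rw [character_sub, map_mul, Complex.conj_conj]; ring
  have hint : ∀ l, Integrable fun x => g x * (starRingEnd ℂ) (character l x) := fun l =>
    hg.mul_bdd (c := 1) (by fun_prop) (Filter.Eventually.of_forall fun x => by
      rw [RCLike.norm_conj, norm_character])
  simp_rw [coeff, h]
  rw [integral_finsetSum _ fun j _ => (hint _).const_mul _, Finset.mul_sum]
  simp_rw [integral_const_mul]
  exact Finset.sum_congr rfl fun j _ => by rw [coeff]; ring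

open scoped Pointwise in
theorem mul (hf : IsTrigPoly S f) (hg : IsTrigPoly S' g) :
    IsTrigPoly (S + S') fun x => f x * g x := by
  refine ⟨fun k => ∑ j ∈ S, coeff f j * coeff g (k - j), funext fun x => ?_⟩
  have key : ∀ j ∈ S, coeff f j * character j x * g x =
      ∑ k ∈ S + S', coeff f j * coeff g (k - j) * character k x := by
    intro j hj
    have hsub : S'.image (fun l => j + l) ⊆ S + S' := by
      intro k hk
      obtain ⟨l, hl, rfl⟩ := Finset.mem_image.1 hk
      exact Finset.add_mem_add hj hl
    rw [← Finset.sum_subset hsub, Finset.sum_image fun a _ b _ h => add_left_cancel h, hg.eq_sum x,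
      Finset.mul_sum]
    · refine Finset.sum_congr rfl fun l _ => ?_
      rw [add_sub_cancel_left, character_add]; ring
    · intro k _ hk
      rw [hg.coeff_eq_zero (k := k - j), mul_zero, zero_mul]
      exact fun h => hk (Finset.mem_image.2 ⟨k - j, h, by abel⟩)
  rw [hf.eq_sum x, Finset.sum_mul, Finset.sum_congr rfl key, Finset.sum_comm]
  simp_rw [Finset.sum_mul]

open scoped Pointwise in
theorem conj (hf : IsTrigPoly S f) : IsTrigPoly (-S) fun x => (starRingEnd ℂ) (f x) := by
  refine ⟨fun k => (starRingEnd ℂ) (coeff f (-k)), funext fun x => ?_⟩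
  rw [hf.eq_sum x, Finset.sum_neg_index, map_sum]
  refine Finset.sum_congr rfl fun k _ => ?_
  simp only [map_mul, neg_neg, character_neg]

theorem lintegral_enorm_sq (hf : IsTrigPoly S f) :
    ∫⁻ x, ‖f x‖ₑ ^ 2 = ENNReal.ofReal (4 * π ^ 2) * ∑' k, ‖coeff f k‖ₑ ^ 2 := by
  have hint : Integrable fun x => ‖f x‖ ^ 2 := (memLp_of_continuous hf.continuous 2).integrable_norm_pow'
  have e1 : ∀ z : ℂ, ‖z‖ₑ ^ 2 = ENNReal.ofReal (‖z‖ ^ 2) := fun z => by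
    rw [ENNReal.ofReal_pow (norm_nonneg _), ofReal_norm]
  have hcomplex : ∫ x, f x * (starRingEnd ℂ) (f x) =
      4 * (π : ℂ) ^ 2 * ∑ k ∈ S, coeff f k * (starRingEnd ℂ) (coeff f k) := by
    have h : ∀ x, f x * (starRingEnd ℂ) (f x) = ∑ k ∈ S, (starRingEnd ℂ) (coeff f k) *
        (f x * (starRingEnd ℂ) (character k x)) := fun x => by
      conv_lhs => rw [hf.eq_sum x, map_sum, ← hf.eq_sum x]
      rw [Finset.mul_sum]
      exact Finset.sum_congr rfl fun k _ => by rw [map_mul]; ring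
    simp_rw [h]
    have hc := hf.continuous
    rw [integral_finsetSum _ fun j _ => integrable_of_continuous (by fun_prop), Finset.mul_sum]
    refine Finset.sum_congr rfl fun k _ => ?_
    rw [integral_const_mul, integral_mul_conj_character]; ring
  have hreal : ∫ x, ‖f x‖ ^ 2 = 4 * π ^ 2 * ∑ k ∈ S, ‖coeff f k‖ ^ 2 := by
    simp_rw [Complex.mul_conj'] at hcomplex
    have : ∀ x, (‖f x‖ : ℂ) ^ 2 = ((‖f x‖ ^ 2 : ℝ) : ℂ) := fun x => by push_cast; rfl
    simp_rw [this] at hcomplex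
    rw [integral_complex_ofReal] at hcomplex
    exact_mod_cast hcomplex
  rw [tsum_eq_sum (s := S) fun k hk => by simp [hf.coeff_eq_zero hk]]
  simp_rw [e1]
  rw [← ofReal_integral_eq_lintegral_ofReal hint (Filter.Eventually.of_forall fun _ => by positivity),
    hreal, ENNReal.ofReal_mul (by positivity), ENNReal.ofReal_sum_of_nonneg fun _ _ => by positivity]

end IsTrigPoly

theorem coeff_conj (f : Torus → ℂ) (k : Freq) :
    coeff (fun x => (starRingEnd ℂ) (f x)) k = (starRingEnd ℂ) (coeff f (-k)) := by
  rw [coeff, coeff, map_mul, ← integral_conj]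
  congr 1
  · simp [map_ofNat]
  · refine integral_congr_ae (Filter.Eventually.of_forall fun x => ?_)
    simp [character_neg]

theorem isTrigPoly_filterProj (τ : ℝ) (f : Torus → ℂ) :
    IsTrigPoly (lowFreq τ) (filterProj τ f) := ⟨coeff f, rfl⟩

theorem coeff_filterProj (τ : ℝ) (f : Torus → ℂ) (k : Freq) :
    coeff (filterProj τ f) k = if k ∈ lowFreq τ then coeff f k else 0 :=
  coeff_sum_character _ _ _

end TrigPoly

/-! ### Majorants of space-time Fourier transforms -/

section Majorant

theorem memℓp_coeff_filterProj (τ : ℝ) {u : ℤ → Torus → ℂ} (hu : ∀ k, Memℓp (fun n => coeff (u n) k) 2)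
    (k : Freq) : Memℓp (fun n => coeff (filterProj τ (u n)) k) 2 := by
  simp_rw [coeff_filterProj]
  by_cases hk : k ∈ lowFreq τ
  · simpa [hk] using hu k
  · simp only [hk, if_false]
    exact zero_memℓp

variable {τ : ℝ} [hτ : Fact (0 < τ)]

/-- A sequence of trigonometric polynomials, with square summable coefficients, whose space-time
Fourier transform is bounded by `f`. -/
structure Majorized (τ : ℝ) [Fact (0 < τ)] (U : ℤ → Torus → ℂ) (f : Phase τ → ℝ≥0∞) : Prop where
  trig : ∃ S, ∀ n, IsTrigPoly S (U n)
  memℓp : ∀ k, Memℓp (fun n => coeff (U n) k) 2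
  le : ∀ k, ∀ᵐ σ, ‖timeFT τ (fun n => coeff (U n) k) σ‖ₑ ≤ f (k, σ)

namespace Majorized

variable {U V : ℤ → Torus → ℂ} {f g : Phase τ → ℝ≥0∞}

/-- The frequency convolution in space is a finite sum over `S`, each term of which is a convolution
in `σ`; enlarging `S` to all of `ℤ²` gives the convolution on phase space. -/
theorem mul (hU : Majorized τ U f) (hV : Majorized τ V g) (hf : Measurable f) (hg : Measurable g) :
    Majorized τ (fun n x => U n x * V n x) (f ⋆ₗ[phaseMeasure τ] g) := by
  obtain ⟨S, hS⟩ := hU.trig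
  obtain ⟨S', hS'⟩ := hV.trig
  have hcoeff : ∀ k, (fun n => coeff (fun x => U n x * V n x) k) =
      fun n => ∑ j ∈ S, coeff (U n) j * coeff (V n) (k - j) := fun k => funext fun n =>
    (hS n).coeff_mul (integrable_of_continuous (hS' n).continuous) k
  refine ⟨⟨_, fun n => (hS n).mul (hS' n)⟩, fun k => ?_, fun k => ?_⟩
  · rw [hcoeff]
    have := Memℓp.finsetSum S (f := fun j n => coeff (U n) j * coeff (V n) (k - j))
      fun j _ => memℓp_two_mul (hU.memℓp j) (hV.memℓp (k - j))
    simpa [Finset.sum_fn] using this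
  · rw [hcoeff]
    filter_upwards [enorm_timeFT_sum_mul_le S (c := fun j n => coeff (U n) j)
      (d := fun j n => coeff (V n) (k - j)) (fun j => hU.memℓp j)
      (fun j => hV.memℓp (k - j))] with σ hσ
    refine hσ.trans ?_
    rw [lconvolution_def, lintegral_phaseMeasure τ (by fun_prop)]
    refine le_trans (Finset.sum_le_sum fun j _ => ?_) (ENNReal.sum_le_tsum S)
    have hqm : MeasurePreserving (fun x : AddCircle (2 * π / τ) => -x + σ) :=
      (measurePreserving_add_right volume σ).comp (Measure.measurePreserving_neg volume)
    refine lintegral_mono_ae ?_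
    filter_upwards [hU.le j, hqm.quasiMeasurePreserving.ae (hV.le (k - j))] with x h1 h2
    simp only [Prod.neg_mk, Prod.mk_add_mk, neg_add_eq_sub] at h2 ⊢
    gcongr

theorem conj (hU : Majorized τ U f) :
    Majorized τ (fun n x => (starRingEnd ℂ) (U n x)) fun p => f (-p) := by
  obtain ⟨S, hS⟩ := hU.trig
  refine ⟨⟨_, fun n => (hS n).conj⟩, fun k => ?_, fun k => ?_⟩
  · simp_rw [coeff_conj]
    exact memℓp_two_conj (hU.memℓp (-k))
  · simp_rw [coeff_conj]
    filter_upwards [enorm_timeFT_conj (τ := τ) (hU.memℓp (-k)),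
      (Measure.measurePreserving_neg volume).quasiMeasurePreserving.ae (hU.le (-k))] with σ h1 h2
    rw [h1]
    exact h2

end Majorized

/-- The modulus of the space-time Fourier transform, restricted to the filtered frequencies. -/
def lowFT (τ : ℝ) [Fact (0 < τ)] (u : ℤ → Torus → ℂ) (p : Phase τ) : ℝ≥0∞ :=
  if p.1 ∈ lowFreq τ then ‖timeFT τ (fun n => coeff (u n) p.1) p.2‖ₑ else 0

@[fun_prop]
theorem measurable_lowFT (u : ℤ → Torus → ℂ) : Measurable (lowFT τ u) := by
  refine measurable_phase fun k => ?_
  by_cases hk : k ∈ lowFreq τ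
  · simp only [lowFT, hk, if_true]
    exact (stronglyMeasurable_timeFT _).measurable.enorm
  · simp [lowFT, hk]

theorem lowSupported_lowFT (u : ℤ → Torus → ℂ) : LowSupported τ (lowFT τ u) :=
  fun _ hp => if_neg hp

theorem timeFT_zero : timeFT τ (fun _ => 0) = 0 := by simp [timeFT]

theorem timeFT_filterProj_ae_eq (u : ℤ → Torus → ℂ) (k : Freq) :
    ∀ᵐ σ, ‖timeFT τ (fun n => coeff (filterProj τ (u n)) k) σ‖ₑ = lowFT τ u (k, σ) := by
  simp_rw [coeff_filterProj]
  by_cases hk : k ∈ lowFreq τ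
  · simp [lowFT, hk]
  · simp only [hk, if_false, timeFT_zero, lowFT]
    exact Filter.Eventually.of_forall fun σ => by simp

theorem majorized_filterProj {u : ℤ → Torus → ℂ} (hu : ∀ k, Memℓp (fun n => coeff (u n) k) 2) :
    Majorized τ (fun n => filterProj τ (u n)) (lowFT τ u) where
  trig := ⟨_, fun n => isTrigPoly_filterProj τ (u n)⟩
  memℓp := memℓp_coeff_filterProj τ hu
  le k := by filter_upwards [timeFT_filterProj_ae_eq u k] with σ hσ using hσ.le

end Majorant

/-! ### Comparison of phase-space weights with Bourgain norms -/

section Comparison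

variable {τ : ℝ} [hτ : Fact (0 < τ)]

theorem period_eq (τ : ℝ) : -π / τ + 2 * π / τ = π / τ := by ring

theorem l2_phaseMeasure_eq {F : Phase τ → ℝ≥0∞} (hF : Measurable F) :
    l2 (phaseMeasure τ) F = (∑' k : Freq, ∫⁻ σ in Set.Ioc (-π / τ) (π / τ),
      F (k, (σ : AddCircle (2 * π / τ))) ^ 2) ^ (1 / 2 : ℝ) := by
  rw [l2, lintegral_phaseMeasure τ (by fun_prop)]
  congr 2
  ext1 k
  rw [← AddCircle.lintegral_preimage (2 * π / τ) (-π / τ), period_eq]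

theorem modulation_le (k : Freq) (σ : ℝ) :
    modulation τ (k, (σ : AddCircle (2 * π / τ))) ≤ 4 * bracket (dTau τ (σ - freqSq k)) := by
  have h := one_add_norm_le_bracket_dTau τ (σ - freqSq k)
  rw [AddCircle.coe_sub] at h
  simp only [modulation]
  linarith

theorem weight_le_symbol {b : ℝ} (hb : 0 ≤ b) (s : ℝ) (k : Freq) (σ : ℝ) :
    weight τ s b (k, (σ : AddCircle (2 * π / τ))) ≤ ENNReal.ofReal (4 ^ b) *
      ‖((spaceBracket k ^ s * bracket (dTau τ (σ - freqSq k)) ^ b : ℝ) : ℂ)‖ₑ := by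
  have h0 : 0 ≤ spaceBracket k ^ s := Real.rpow_nonneg (Real.sqrt_nonneg _) _
  have h1 : 0 ≤ bracket (dTau τ (σ - freqSq k)) := Real.sqrt_nonneg _
  rw [← ofReal_norm, Complex.norm_real, Real.norm_of_nonneg (by positivity),
    ← ENNReal.ofReal_mul (by positivity), weight]
  refine ENNReal.ofReal_le_ofReal ?_
  have := Real.rpow_le_rpow (modulation_pos τ _).le (modulation_le (τ := τ) k σ) hb
  rw [Real.mul_rpow (by norm_num) h1] at this
  calc _ ≤ spaceBracket k ^ s * (4 ^ b * bracket (dTau τ (σ - freqSq k)) ^ b) := by gcongr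
    _ = _ := by ring

theorem symbol_le_weight {b : ℝ} (hb : 0 ≤ b) (s : ℝ) (k : Freq) (σ : ℝ) :
    ‖((spaceBracket k ^ s * bracket (dTau τ (σ - freqSq k)) ^ (-b) : ℝ) : ℂ)‖ₑ ≤
      ENNReal.ofReal (4 ^ b) * weight τ s (-b) (k, (σ : AddCircle (2 * π / τ))) := by
  have h0 : 0 ≤ spaceBracket k ^ s := Real.rpow_nonneg (Real.sqrt_nonneg _) _
  have h1 : 0 ≤ bracket (dTau τ (σ - freqSq k)) := Real.sqrt_nonneg _
  have hm := modulation_pos τ (k, (σ : AddCircle (2 * π / τ)))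
  rw [← ofReal_norm, Complex.norm_real, Real.norm_of_nonneg (by positivity), weight,
    ← ENNReal.ofReal_mul (by positivity)]
  refine ENNReal.ofReal_le_ofReal ?_
  have h2 : modulation τ (k, (σ : AddCircle (2 * π / τ))) / 4 ≤ bracket (dTau τ (σ - freqSq k)) := by
    linarith [modulation_le (τ := τ) k σ]
  have := Real.rpow_le_rpow_of_nonpos (by positivity) h2 (neg_nonpos.2 hb)
  rw [Real.div_rpow hm.le (by norm_num), Real.rpow_neg (by norm_num : (0 : ℝ) ≤ 4), div_inv_eq_mul]
    at this
  calc _ ≤ spaceBracket k ^ s * (modulation τ (k, (σ : AddCircle (2 * π / τ))) ^ (-b) * 4 ^ b) := by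
        gcongr
    _ = _ := by ring

theorem rpow_half_mul_sq (c x : ℝ≥0∞) :
    (c ^ 2 * x) ^ (1 / 2 : ℝ) = c * x ^ (1 / 2 : ℝ) := by
  rw [ENNReal.mul_rpow_of_nonneg _ _ (by norm_num), ← ENNReal.rpow_natCast, ← ENNReal.rpow_mul]
  norm_num

theorem l2_weight_lowFT_le {b : ℝ} (hb : 0 ≤ b) (s : ℝ) (u : ℤ → Torus → ℂ) :
    l2 (phaseMeasure τ) (fun p => weight τ s b p * lowFT τ u p) ≤
      ENNReal.ofReal (4 ^ b) * XNorm τ s b u := by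
  rw [l2_phaseMeasure_eq (by fun_prop), XNorm, ← rpow_half_mul_sq, ← ENNReal.tsum_mul_left]
  refine ENNReal.rpow_le_rpow (ENNReal.tsum_le_tsum fun k => ?_) (by norm_num)
  rw [← lintegral_const_mul' _ _ (by simp)]
  refine lintegral_mono fun σ => ?_
  rw [← mul_pow, enorm_mul, ← mul_assoc]
  gcongr
  · exact weight_le_symbol hb s k σ
  · rw [lowFT]
    split_ifs
    · rfl
    · exact zero_le

theorem xNorm_filterProj_le {b : ℝ} (hb : 0 ≤ b) (s : ℝ) (u : ℤ → Torus → ℂ) :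
    XNorm τ s (-b) (fun n => filterProj τ (u n)) ≤ ENNReal.ofReal (4 ^ b) *
      l2 (phaseMeasure τ) (fun p => weight τ s (-b) p * lowFT τ u p) := by
  rw [l2_phaseMeasure_eq (by fun_prop), XNorm, ← rpow_half_mul_sq, ← ENNReal.tsum_mul_left]
  refine ENNReal.rpow_le_rpow (ENNReal.tsum_le_tsum fun k => ?_) (by norm_num)
  rw [← lintegral_const_mul' _ _ (by simp)]
  have hmp := AddCircle.measurePreserving_mk (2 * π / τ) (-π / τ)
  rw [period_eq] at hmp
  refine lintegral_mono_ae ?_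
  filter_upwards [hmp.quasiMeasurePreserving.ae (timeFT_filterProj_ae_eq u k)] with σ hσ
  rw [← mul_pow, enorm_mul, ← mul_assoc, spaceTimeFT, hσ]
  gcongr
  exact symbol_le_weight hb s k σ

/-- Only finitely many frequencies occur and the modulation factor is at most `1`. This a priori
finiteness yields membership in the target space and permits division in the duality argument. -/
theorem l2_weight_lowFT_lt_top {b : ℝ} (hb : 0 ≤ b) (s : ℝ) (u : ℤ → Torus → ℂ) :
    l2 (phaseMeasure τ) (fun p => weight τ s (-b) p * lowFT τ u p) < ∞ := by
  rw [l2]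
  refine ENNReal.rpow_lt_top_of_nonneg (by norm_num) (ne_of_lt ?_)
  rw [lintegral_phaseMeasure τ (by fun_prop),
    tsum_eq_sum (s := lowFreq τ) fun k hk => by simp [lowFT, hk]]
  refine ENNReal.sum_lt_top.2 fun k hk => ?_
  refine lt_of_le_of_lt (lintegral_mono (g := fun σ => ENNReal.ofReal (spaceBracket k ^ s) ^ 2 *
    ‖timeFT τ (fun n => coeff (u n) k) σ‖ₑ ^ 2) fun σ => ?_) ?_
  · have h1 : modulation τ (k, σ) ^ (-b) ≤ 1 :=
      Real.rpow_le_one_of_one_le_of_nonpos (by simp [modulation]) (by linarith)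
    have h0 : 0 ≤ spaceBracket k ^ s := Real.rpow_nonneg (Real.sqrt_nonneg _) _
    simp only [lowFT, hk, if_true, mul_pow, weight]
    gcongr
    exact mul_le_of_le_one_right h0 h1
  · rw [lintegral_const_mul' _ _ (by simp)]
    exact ENNReal.mul_lt_top (by simp) (lintegral_timeFT_lt_top _)

end Comparison

/-! ### The `L⁴` estimate -/

section Strichartz

theorem weight_zero_le {τ s : ℝ} (hs : 0 ≤ s) (b : ℝ) (p : Phase τ) :
    weight τ 0 b p ≤ weight τ s b p := by
  unfold weight
  have := Real.rpow_nonneg (modulation_pos τ p).le b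
  refine ENNReal.ofReal_le_ofReal (mul_le_mul_of_nonneg_right ?_ this)
  exact Real.rpow_le_rpow_of_exponent_le (one_le_spaceBracket _) hs

/-- The fourth power of the `L⁴` norm of `U` is the squared `L²` norm of `U²`; Parseval in space and
in time then passes to `f ⋆ f`. -/
theorem tsum_eLpNorm_four_le {τ : ℝ} [Fact (0 < τ)] {U : ℤ → Torus → ℂ} {f : Phase τ → ℝ≥0∞}
    (hf : Measurable f) (hU : Majorized τ U f) :
    ENNReal.ofReal τ * ∑' n, eLpNorm (U n) (ENNReal.ofReal 4) volume ^ (4 : ℝ) ≤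
      ENNReal.ofReal (4 * π ^ 2) * l2 (phaseMeasure τ) (f ⋆ₗ[phaseMeasure τ] f) ^ 2 := by
  have hUU := hU.mul hU hf hf
  obtain ⟨S, hS⟩ := hUU.trig
  have h4 : ∀ n, eLpNorm (U n) (ENNReal.ofReal 4) volume ^ (4 : ℝ) =
      ENNReal.ofReal (4 * π ^ 2) * ∑' k, ‖coeff (fun x => U n x * U n x) k‖ₑ ^ 2 := by
    intro n
    rw [← (hS n).lintegral_enorm_sq, eLpNorm_eq_lintegral_rpow_enorm_toReal (by simp) (by simp),
      ENNReal.toReal_ofReal (by norm_num), ← ENNReal.rpow_mul]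
    norm_num
    refine lintegral_congr fun x => ?_
    exact_mod_cast (by ring : ‖U n x‖ₑ ^ 4 = (‖U n x‖ₑ * ‖U n x‖ₑ) ^ 2)
  simp_rw [h4]
  rw [ENNReal.tsum_mul_left, mul_left_comm, ENNReal.tsum_comm, ← ENNReal.tsum_mul_left, l2_sq,
    lintegral_phaseMeasure τ (by fun_prop)]
  gcongr with k
  refine (tsum_enorm_sq_le_lintegral_timeFT (hUU.memℓp k)).trans (lintegral_mono_ae ?_)
  filter_upwards [hUU.le k] with σ hσ
  gcongr

theorem seqLpNorm_four_le {s b : ℝ} (hs : 0 < s) (hb : 1 / 2 < b) :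
    ∃ C : ℝ≥0, ∀ (τ : ℝ) [Fact (0 < τ)] (u : ℤ → Torus → ℂ), MemX τ s b u →
      seqLpNorm τ 4 (fun n => filterProj τ (u n)) ≤ C * XNorm τ s b u := by
  obtain ⟨C, hC⟩ := exists_l2_lconvolution_le (s := s) (b := b) hs
    (max_lt (by linarith) (by linarith))
  set c : ℝ≥0 := (4 ^ b : ℝ).toNNReal with hc
  set D : ℝ≥0 := (4 * π ^ 2 : ℝ).toNNReal * (C * (c * c)) ^ 2 with hD
  refine ⟨D ^ (1 / 4 : ℝ), fun τ _ u hu => ?_⟩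
  have hm : Measurable (lowFT τ u) := measurable_lowFT u
  have hN : l2 (phaseMeasure τ) (fun p => weight τ s b p * lowFT τ u p) ≤ c * XNorm τ s b u :=
    l2_weight_lowFT_le (by linarith) s u
  have hN0 : l2 (phaseMeasure τ) (fun p => weight τ 0 b p * lowFT τ u p) ≤ c * XNorm τ s b u :=
    (l2_mono _ (Filter.Eventually.of_forall fun p => by
      gcongr; exact weight_zero_le hs.le b p)).trans hN
  have hbil := hC τ _ _ hm hm (lowSupported_lowFT u) (lowSupported_lowFT u)
  have hmain := tsum_eLpNorm_four_le hm
    (majorized_filterProj fun k => memℓp_two_iff.2 (hu.summable k))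
  have hfin : ENNReal.ofReal (4 * π ^ 2) *
      l2 (phaseMeasure τ) (lowFT τ u ⋆ₗ[phaseMeasure τ] lowFT τ u) ^ 2 ≤
      (D : ℝ≥0∞) * XNorm τ s b u ^ (4 : ℝ) := by
    calc _ ≤ ENNReal.ofReal (4 * π ^ 2) *
          (C * ((c * XNorm τ s b u) * (c * XNorm τ s b u))) ^ 2 := by
          gcongr; exact hbil.trans (by gcongr)
      _ = _ := by
          have h1 : XNorm τ s b u ^ (4 : ℝ) = XNorm τ s b u ^ 4 := by
            exact_mod_cast ENNReal.rpow_natCast _ 4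
          rw [h1, hD, ENNReal.coe_mul, ENNReal.ofReal]
          push_cast
          ring
  rw [seqLpNorm]
  refine (ENNReal.rpow_le_rpow (hmain.trans hfin) (by norm_num)).trans_eq ?_
  rw [ENNReal.mul_rpow_of_nonneg _ _ (by norm_num), ← ENNReal.rpow_mul,
    ENNReal.coe_rpow_of_nonneg _ (by norm_num)]
  norm_num

end Strichartz

/-! ### Trilinear estimates by duality -/

section Trilinear

/-- The product whose filtered version is `cubic`. -/
def cubicProduct (τ : ℝ) (u : Fin 3 → ℤ → Torus → ℂ) (n : ℤ) (x : Torus) : ℂ :=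
  filterProj τ (u 0 n) x * (starRingEnd ℂ) (filterProj τ (u 1 n) x) * filterProj τ (u 2 n) x

theorem cubic_eq (τ : ℝ) (u : Fin 3 → ℤ → Torus → ℂ) :
    cubic τ (u 0) (u 1) (u 2) = fun n => filterProj τ (cubicProduct τ u n) := rfl

/-- Each use of the bilinear estimate needs one factor carrying `⟨k⟩^s`, so `f (ρ 2)` and `v` must
land in different pairs. If `ρ 2` is `0` or `2` the pairs are `f 0, f 2` and `f 1, v`; if it is `1`
they are `f 0, f 1` and `f 2, v`. -/
theorem exists_trilinear_le {s b : ℝ} (hs : 0 < s) (hb : max (1 / 4) (1 / 2 - s / 4) < b) :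
    ∃ C : ℝ≥0, ∀ (τ : ℝ) [Fact (0 < τ)] (f : Fin 3 → Phase τ → ℝ≥0∞) (v : Phase τ → ℝ≥0∞),
      (∀ i, Measurable (f i)) → Measurable v → (∀ i, LowSupported τ (f i)) → LowSupported τ v →
      ∀ ρ : Equiv.Perm (Fin 3),
      ∫⁻ p, ((f 0 ⋆ₗ[phaseMeasure τ] f 2) ⋆ₗ[phaseMeasure τ] fun p => f 1 (-p)) p * v p
          ∂phaseMeasure τ ≤
        C * (l2 (phaseMeasure τ) (fun p => weight τ s b p * f (ρ 0) p) *
          l2 (phaseMeasure τ) (fun p => weight τ s b p * f (ρ 1) p) *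
          l2 (phaseMeasure τ) (fun p => weight τ 0 b p * f (ρ 2) p)) *
          l2 (phaseMeasure τ) (fun p => weight τ 0 b p * v p) := by
  obtain ⟨C, hC⟩ := exists_l2_lconvolution_le hs hb
  refine ⟨C * C, fun τ _ f v hf hv hfs hvs ρ => ?_⟩
  have h01 : ρ 0 ≠ ρ 1 := ρ.injective.ne (by decide)
  have h02 : ρ 0 ≠ ρ 2 := ρ.injective.ne (by decide)
  have h12 : ρ 1 ≠ ρ 2 := ρ.injective.ne (by decide)
  have hb := fun i j => hC τ (f i) (f j) (hf i) (hf j) (hfs i) (hfs j)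
  have hbv := fun i => hC τ (f i) v (hf i) hv (hfs i) hvs
  have hA := lintegral_trilinear_le (μ := phaseMeasure τ) (hf 0) (hf 1) (hf 2) hv
  have hB := lintegral_trilinear_le' (μ := phaseMeasure τ) (hf 0) (hf 1) (hf 2) hv
  rw [lconvolution_comm (f := v)] at hB
  have hA' := hA
  rw [lconvolution_comm (f := f 0) (g := f 2)] at hA'
  have e : ∀ a b c d : ℝ≥0∞, (C * (a * b)) * (C * (c * d)) = ((C * C : ℝ≥0) : ℝ≥0∞) * (a * c * b) * d := by
    intro a b c d; push_cast; ring
  have e' : ∀ a b c d : ℝ≥0∞, (C * (a * b)) * (C * (c * d)) = ((C * C : ℝ≥0) : ℝ≥0∞) * (c * a * b) * d := by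
    intro a b c d; push_cast; ring
  generalize ρ 0 = i at *
  generalize ρ 1 = j at *
  generalize ρ 2 = k at *
  have hk : k = 0 ∨ k = 1 ∨ k = 2 := by omega
  rcases hk with rfl | rfl | rfl
  · have hij : (i = 1 ∧ j = 2) ∨ (i = 2 ∧ j = 1) := by omega
    rw [lconvolution_comm (f := f 0) (g := f 2)]
    have := hA'.trans (mul_le_mul' (hb 2 0) (hbv 1))
    rcases hij with ⟨rfl, rfl⟩ | ⟨rfl, rfl⟩
    · rwa [e'] at this
    · rwa [e] at this
  · have hij : (i = 0 ∧ j = 2) ∨ (i = 2 ∧ j = 0) := by omega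
    have := hB.trans (mul_le_mul' (hb 0 1) (hbv 2))
    rcases hij with ⟨rfl, rfl⟩ | ⟨rfl, rfl⟩
    · rwa [e] at this
    · rwa [e'] at this
  · have hij : (i = 0 ∧ j = 1) ∨ (i = 1 ∧ j = 0) := by omega
    have := hA.trans (mul_le_mul' (hb 0 2) (hbv 1))
    rcases hij with ⟨rfl, rfl⟩ | ⟨rfl, rfl⟩
    · rwa [e] at this
    · rwa [e'] at this

theorem spaceBracket_rpow_le {s : ℝ} (hs : 0 ≤ s) (j k : Freq) :
    spaceBracket k ^ s ≤ 2 ^ s * (spaceBracket j ^ s + spaceBracket (-j + k) ^ s) := by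
  have h0 : ∀ k, 0 ≤ spaceBracket k := fun k => Real.sqrt_nonneg _
  have h1 : spaceBracket k ≤ 2 * max (spaceBracket j) (spaceBracket (-j + k)) := by
    refine Real.sqrt_le_iff.2 ⟨by have := le_max_left (spaceBracket j) (spaceBracket (-j + k)); linarith [h0 j], ?_⟩
    have h2 : spaceBracket j ^ 2 ≤ max (spaceBracket j) (spaceBracket (-j + k)) ^ 2 :=
      pow_le_pow_left₀ (h0 _) (le_max_left _ _) 2
    have h3 : spaceBracket (-j + k) ^ 2 ≤ max (spaceBracket j) (spaceBracket (-j + k)) ^ 2 :=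
      pow_le_pow_left₀ (h0 _) (le_max_right _ _) 2
    rw [spaceBracket_sq, freqSq_eq] at h2 h3
    rw [freqSq_eq, mul_pow]
    simp only [Pi.add_apply, Pi.neg_apply] at h3
    push_cast at h3
    nlinarith [sq_nonneg (2 * (j 0 : ℝ) - k 0), sq_nonneg (2 * (j 1 : ℝ) - k 1)]
  calc _ ≤ (2 * max (spaceBracket j) (spaceBracket (-j + k))) ^ s := Real.rpow_le_rpow (h0 _) h1 hs
    _ = 2 ^ s * max (spaceBracket j) (spaceBracket (-j + k)) ^ s :=
        Real.mul_rpow (by norm_num) (le_max_of_le_left (h0 _))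
    _ ≤ _ := by
        gcongr
        rcases max_cases (spaceBracket j) (spaceBracket (-j + k)) with ⟨h, -⟩ | ⟨h, -⟩ <;> rw [h]
        · exact le_add_of_nonneg_right (Real.rpow_nonneg (h0 _) _)
        · exact le_add_of_nonneg_left (Real.rpow_nonneg (h0 _) _)

variable {τ : ℝ} [hτ : Fact (0 < τ)]

theorem weight_neg (τ s : ℝ) (p : Phase τ) : weight τ s 0 (-p) = weight τ s 0 p := by
  simp [weight, spaceBracket, freqSq]

theorem weight_mul_lconvolution_le {s : ℝ} (hs : 0 ≤ s) {f g : Phase τ → ℝ≥0∞} (hf : Measurable f)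
    (hg : Measurable g) (p : Phase τ) :
    weight τ s 0 p * (f ⋆ₗ[phaseMeasure τ] g) p ≤ ENNReal.ofReal (2 ^ s) *
      (((fun p => weight τ s 0 p * f p) ⋆ₗ[phaseMeasure τ] g) p +
        (f ⋆ₗ[phaseMeasure τ] fun p => weight τ s 0 p * g p) p) := by
  simp only [lconvolution_def]
  rw [← lintegral_add_left (by fun_prop), ← lintegral_const_mul _ (by fun_prop),
    ← lintegral_const_mul _ (by fun_prop)]
  refine lintegral_mono fun q => ?_
  have h : weight τ s 0 p ≤ ENNReal.ofReal (2 ^ s) * (weight τ s 0 q + weight τ s 0 (-q + p)) := by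
    have h0 : ∀ k, 0 ≤ spaceBracket k ^ s := fun k => Real.rpow_nonneg (Real.sqrt_nonneg _) _
    simp only [weight, Real.rpow_zero, mul_one]
    rw [← ENNReal.ofReal_add (h0 _) (h0 _), ← ENNReal.ofReal_mul (by positivity)]
    exact ENNReal.ofReal_le_ofReal (spaceBracket_rpow_le hs q.1 p.1)
  calc _ ≤ ENNReal.ofReal (2 ^ s) * (weight τ s 0 q + weight τ s 0 (-q + p)) *
        (f q * g (-q + p)) := by gcongr
    _ = _ := by ring

theorem lconvolution_le_of_le {a b F g : Phase τ → ℝ≥0∞} {c : ℝ≥0∞} (ha : Measurable a)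
    (hb : Measurable b) (hg : Measurable g) (h : ∀ p, F p ≤ c * (a p + b p)) (p : Phase τ) :
    (F ⋆ₗ[phaseMeasure τ] g) p ≤
      c * ((a ⋆ₗ[phaseMeasure τ] g) p + (b ⋆ₗ[phaseMeasure τ] g) p) := by
  simp only [lconvolution_def]
  rw [← lintegral_add_left (by fun_prop), ← lintegral_const_mul _ (by fun_prop)]
  refine lintegral_mono fun q => ?_
  calc _ ≤ c * (a q + b q) * g (-q + p) := by gcongr; exact h q
    _ = _ := by ring

/-- Two uses of the triangle inequality move `⟨k⟩^s` onto one factor at a time. The reflected factor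
is reached after one use and takes a superfluous `2 ^ s`, so that the three terms share a constant.
-/
theorem weight_mul_trilinear_le {s : ℝ} (hs : 0 ≤ s) {f₁ f₂ f₃ : Phase τ → ℝ≥0∞}
    (h₁ : Measurable f₁) (h₂ : Measurable f₂) (h₃ : Measurable f₃) (p : Phase τ) :
    weight τ s 0 p * ((f₁ ⋆ₗ[phaseMeasure τ] f₃) ⋆ₗ[phaseMeasure τ] fun p => f₂ (-p)) p ≤
      ENNReal.ofReal (2 ^ s) ^ 2 *
      ((((fun p => weight τ s 0 p * f₁ p) ⋆ₗ[phaseMeasure τ] f₃) ⋆ₗ[phaseMeasure τ]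
          fun p => f₂ (-p)) p +
        ((f₁ ⋆ₗ[phaseMeasure τ] fun p => weight τ s 0 p * f₃ p) ⋆ₗ[phaseMeasure τ]
          fun p => f₂ (-p)) p +
        ((f₁ ⋆ₗ[phaseMeasure τ] f₃) ⋆ₗ[phaseMeasure τ]
          fun p => weight τ s 0 (-p) * f₂ (-p)) p) := by
  have h₂' : Measurable fun p => f₂ (-p) := by fun_prop
  have hK : 1 ≤ ENNReal.ofReal (2 ^ s) := by
    rw [ENNReal.one_le_ofReal]
    exact Real.one_le_rpow (by norm_num) hs
  refine (weight_mul_lconvolution_le hs (by fun_prop) h₂' p).trans ?_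
  have hfirst := lconvolution_le_of_le (by fun_prop) (by fun_prop) h₂'
    (weight_mul_lconvolution_le hs h₁ h₃) p
  simp_rw [weight_neg]
  calc _ ≤ ENNReal.ofReal (2 ^ s) * (ENNReal.ofReal (2 ^ s) * _ + ENNReal.ofReal (2 ^ s) * _) :=
        mul_le_mul_right (add_le_add hfirst (le_mul_of_one_le_left zero_le hK)) _
    _ = _ := by ring

theorem le_of_sq_le_mul {a b : ℝ≥0∞} (ha : a ≠ ∞) (h : a ^ 2 ≤ b * a) : a ≤ b := by
  rcases eq_or_ne a 0 with rfl | h0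
  · exact zero_le
  · rw [sq] at h
    exact (ENNReal.mul_le_mul_iff_left h0 ha).1 h

theorem majorized_cubicProduct {u : Fin 3 → ℤ → Torus → ℂ}
    (hu : ∀ i k, Memℓp (fun n => coeff (u i n) k) 2) :
    Majorized τ (cubicProduct τ u) ((lowFT τ (u 0) ⋆ₗ[phaseMeasure τ] lowFT τ (u 2))
      ⋆ₗ[phaseMeasure τ] fun p => lowFT τ (u 1) (-p)) := by
  have h := ((majorized_filterProj (τ := τ) (hu 0)).mul (majorized_filterProj (hu 2)) (by fun_prop)
    (by fun_prop)).mul (majorized_filterProj (hu 1)).conj (by fun_prop) (by fun_prop)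
  convert h using 1
  ext n x
  simp only [cubicProduct]; ring

theorem lintegral_lowFT_mul_le {U : ℤ → Torus → ℂ} {f v : Phase τ → ℝ≥0∞} (hf : Measurable f)
    (hv : Measurable v) (h : Majorized τ U f) :
    ∫⁻ p, lowFT τ U p * v p ∂phaseMeasure τ ≤ ∫⁻ p, f p * v p ∂phaseMeasure τ := by
  rw [lintegral_phaseMeasure τ (by fun_prop), lintegral_phaseMeasure τ (by fun_prop)]
  refine ENNReal.tsum_le_tsum fun k => lintegral_mono_ae ?_
  filter_upwards [h.le k] with σ hσ
  gcongr
  rw [lowFT]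
  split_ifs
  · exact hσ
  · exact zero_le

theorem memX_cubic {s b : ℝ} (hb : 0 ≤ b) {u : Fin 3 → ℤ → Torus → ℂ}
    (hu : ∀ i k, Memℓp (fun n => coeff (u i n) k) 2) :
    MemX τ s (-b) (cubic τ (u 0) (u 1) (u 2)) where
  memLp _ := memLp_of_continuous (isTrigPoly_filterProj τ _).continuous 2
  summable k := memℓp_two_iff.1
    (memℓp_coeff_filterProj τ (fun k => (majorized_cubicProduct (τ := τ) hu).memℓp k) k)
  norm_lt_top := (xNorm_filterProj_le hb s (cubicProduct τ u)).trans_lt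
    (ENNReal.mul_lt_top ENNReal.ofReal_lt_top (l2_weight_lowFT_lt_top hb s _))

/-- The dual form of the trilinear estimate, tested against the cubic product itself. -/
theorem l2_weight_cubicProduct_le {s b : ℝ} (hb : 0 ≤ b) {u : Fin 3 → ℤ → Torus → ℂ}
    (hu : ∀ i k, Memℓp (fun n => coeff (u i n) k) 2) {B : ℝ≥0∞}
    (h : ∀ v : Phase τ → ℝ≥0∞, Measurable v → LowSupported τ v →
      ∫⁻ p, weight τ s 0 p * ((lowFT τ (u 0) ⋆ₗ[phaseMeasure τ] lowFT τ (u 2))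
        ⋆ₗ[phaseMeasure τ] fun p => lowFT τ (u 1) (-p)) p * v p ∂phaseMeasure τ ≤
        B * l2 (phaseMeasure τ) (fun p => weight τ 0 b p * v p)) :
    XNorm τ s (-b) (cubic τ (u 0) (u 1) (u 2)) ≤ ENNReal.ofReal (4 ^ b) * B := by
  rw [cubic_eq]
  refine (xNorm_filterProj_le hb s _).trans ?_
  gcongr
  set G := lowFT τ (cubicProduct τ u) with hG
  have hGm : Measurable G := measurable_lowFT _
  -- With this test function the pairing dominates the square of the norm of `weight τ s (-b) * G`,
  -- and the norm of `v` on the right-hand side is that same norm, to be cancelled.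
  have hv : Measurable fun p => weight τ s (-2 * b) p * G p := by fun_prop
  refine le_of_sq_le_mul (l2_weight_lowFT_lt_top hb s _).ne ?_
  have hvn : (fun p => weight τ 0 b p * (weight τ s (-2 * b) p * G p)) =
      fun p => weight τ s (-b) p * G p := by
    ext p
    rw [← mul_assoc, weight_mul_weight]
    congr 2 <;> ring
  have h1 := h _ hv fun p hp => by rw [hG, lowSupported_lowFT _ p hp, mul_zero]
  rw [hvn] at h1
  refine le_trans ?_ h1
  rw [l2_sq]
  have h2 := lintegral_lowFT_mul_le
    (v := fun p => weight τ s 0 p * (weight τ s (-2 * b) p * G p)) (by fun_prop) (by fun_prop)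
    (majorized_cubicProduct (τ := τ) hu)
  calc _ = ∫⁻ p, G p * (weight τ s 0 p * (weight τ s (-2 * b) p * G p)) ∂phaseMeasure τ := by
        refine lintegral_congr fun p => ?_
        have h3 : weight τ s (-b) p * weight τ s (-b) p =
            weight τ s 0 p * weight τ s (-2 * b) p := by
          rw [weight_mul_weight, weight_mul_weight]; congr 1; ring
        calc _ = (weight τ s (-b) p * weight τ s (-b) p) * (G p * G p) := by ring
          _ = _ := by rw [h3]; ring
    _ ≤ _ := h2
    _ = _ := lintegral_congr fun p => by ring

end Trilinear

/-! ### The cubic estimates with uniform constants -/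

section Main

theorem exists_xNorm_cubic_le_of_perm {s b : ℝ} (hs : 0 < s)
    (hb : max (1 / 4) (1 / 2 - s / 4) < b) :
    ∃ C : ℝ≥0, ∀ (τ : ℝ) [Fact (0 < τ)] (ρ : Equiv.Perm (Fin 3)) (u : Fin 3 → ℤ → Torus → ℂ),
      (∀ i k, Memℓp (fun n => coeff (u i n) k) 2) →
      XNorm τ 0 (-b) (cubic τ (u 0) (u 1) (u 2)) ≤
        C * (XNorm τ s b (u (ρ 0)) * XNorm τ s b (u (ρ 1)) * XNorm τ 0 b (u (ρ 2))) := by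
  have hb0 : 0 ≤ b := (by norm_num : (0 : ℝ) ≤ 1 / 4).trans ((le_max_left _ _).trans hb.le)
  obtain ⟨C, hC⟩ := exists_trilinear_le hs hb
  set c : ℝ≥0 := (4 ^ b : ℝ).toNNReal with hc
  -- One factor `c = 4 ^ b` for each of the three inputs and one for the output.
  refine ⟨c ^ 4 * C, fun τ _ ρ u hu => ?_⟩
  have hX : ∀ s' i, l2 (phaseMeasure τ) (fun p => weight τ s' b p * lowFT τ (u i) p) ≤
      c * XNorm τ s' b (u i) := fun s' i => l2_weight_lowFT_le hb0 s' (u i)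
  refine (l2_weight_cubicProduct_le (s := 0) (B := C * ((c * XNorm τ s b (u (ρ 0))) *
    (c * XNorm τ s b (u (ρ 1))) * (c * XNorm τ 0 b (u (ρ 2))))) hb0 hu fun v hv hvs => ?_).trans_eq ?_
  · simp_rw [weight_zero, one_mul]
    refine (hC τ (fun i => lowFT τ (u i)) v (fun i => measurable_lowFT _) hv
      (fun i => lowSupported_lowFT _) hvs ρ).trans ?_
    gcongr <;> exact hX _ _
  · rw [ENNReal.ofReal]
    push_cast
    ring

theorem exists_xNorm_cubic_le {s b : ℝ} (hs : 0 < s) (hb : max (1 / 4) (1 / 2 - s / 4) < b) :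
    ∃ C : ℝ≥0, ∀ (τ : ℝ) [Fact (0 < τ)] (u : Fin 3 → ℤ → Torus → ℂ),
      (∀ i k, Memℓp (fun n => coeff (u i n) k) 2) →
      XNorm τ s (-b) (cubic τ (u 0) (u 1) (u 2)) ≤
        C * (XNorm τ s b (u 0) * XNorm τ s b (u 1) * XNorm τ s b (u 2)) := by
  have hb0 : 0 ≤ b := (by norm_num : (0 : ℝ) ≤ 1 / 4).trans ((le_max_left _ _).trans hb.le)
  obtain ⟨C, hC⟩ := exists_trilinear_le hs hb
  set c : ℝ≥0 := (4 ^ b : ℝ).toNNReal with hc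
  set d : ℝ≥0 := (2 ^ s : ℝ).toNNReal with hd
  refine ⟨c * (d ^ 2 * (3 * C * c ^ 3)), fun τ _ u hu => ?_⟩
  have hX : ∀ i, l2 (phaseMeasure τ) (fun p => weight τ s b p * lowFT τ (u i) p) ≤
      c * XNorm τ s b (u i) := fun i => l2_weight_lowFT_le hb0 s (u i)
  refine (l2_weight_cubicProduct_le (s := s) (B := d ^ 2 * (3 * (C * ((c * XNorm τ s b (u 0)) *
    (c * XNorm τ s b (u 1)) * (c * XNorm τ s b (u 2)))))) hb0 hu fun v hv hvs => ?_).trans_eq ?_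
  · set f : Fin 3 → Phase τ → ℝ≥0∞ := fun i => lowFT τ (u i) with hf
    have hfm : ∀ i, Measurable (f i) := fun i => measurable_lowFT _
    -- In `wf j` the weight `⟨k⟩^s` sits on the `j`-th input only. That input then needs just the
    -- modulation weight, so the trilinear bound applies with a permutation sending `2` to `j`.
    let wf : Fin 3 → Fin 3 → Phase τ → ℝ≥0∞ := fun j i p =>
      if i = j then weight τ s 0 p * f i p else f i p
    have hwm : ∀ j i, Measurable (wf j i) := fun j i => by
      have := hfm i
      by_cases h : i = j <;> simp only [wf, h, if_true, if_false] <;> fun_prop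
    have hws : ∀ j i, LowSupported τ (wf j i) := fun j i p hp => by
      simp [wf, hf, lowSupported_lowFT (u i) p hp]
    have hwe : ∀ j, l2 (phaseMeasure τ) (fun p => weight τ 0 b p * wf j j p) ≤
        c * XNorm τ s b (u j) := fun j => by
      refine le_trans (le_of_eq (congrArg _ (funext fun p => ?_))) (hX j)
      simp only [wf, if_true]
      rw [← mul_assoc, weight_mul_weight]; simp [hf]
    have hwne : ∀ j i, i ≠ j → l2 (phaseMeasure τ) (fun p => weight τ s b p * wf j i p) ≤
        c * XNorm τ s b (u i) := fun j i hij => by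
      simpa only [wf, hij, if_false] using hX i
    have hterm : ∀ ρ : Equiv.Perm (Fin 3),
        ∫⁻ p, ((wf (ρ 2) 0 ⋆ₗ[phaseMeasure τ] wf (ρ 2) 2) ⋆ₗ[phaseMeasure τ]
          fun p => wf (ρ 2) 1 (-p)) p * v p ∂phaseMeasure τ ≤
        C * ((c * XNorm τ s b (u (ρ 0))) * (c * XNorm τ s b (u (ρ 1))) *
          (c * XNorm τ s b (u (ρ 2)))) * l2 (phaseMeasure τ) (fun p => weight τ 0 b p * v p) := by
      intro ρ
      refine (hC τ (wf (ρ 2)) v (hwm _) hv (hws _) hvs ρ).trans ?_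
      gcongr
      · exact hwne _ _ (ρ.injective.ne (by decide))
      · exact hwne _ _ (ρ.injective.ne (by decide))
      · exact hwe _
    let F : Fin 3 → Phase τ → ℝ≥0∞ := fun j =>
      (wf j 0 ⋆ₗ[phaseMeasure τ] wf j 2) ⋆ₗ[phaseMeasure τ] fun p => wf j 1 (-p)
    have hFm : ∀ j, Measurable (F j) := fun j => by
      have h0 := hwm j 0
      have h1 := hwm j 1
      have h2 := hwm j 2
      fun_prop
    set X := l2 (phaseMeasure τ) (fun p => weight τ 0 b p * v p) with hXdef
    set P : ℝ≥0∞ := (c * XNorm τ s b (u 0)) * (c * XNorm τ s b (u 1)) * (c * XNorm τ s b (u 2))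
      with hP
    have t0 : ∫⁻ p, F 0 p * v p ∂phaseMeasure τ ≤ C * P * X := by
      refine (hterm (Equiv.swap 0 2)).trans_eq ?_
      have h1 : Equiv.swap (0 : Fin 3) 2 1 = 1 := by decide
      rw [Equiv.swap_apply_left, Equiv.swap_apply_right, h1, hP]; ring
    have t1 : ∫⁻ p, F 1 p * v p ∂phaseMeasure τ ≤ C * P * X := by
      refine (hterm (Equiv.swap 1 2)).trans_eq ?_
      have h1 : Equiv.swap (1 : Fin 3) 2 0 = 0 := by decide
      rw [Equiv.swap_apply_left, Equiv.swap_apply_right, h1, hP]; ring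
    have t2 : ∫⁻ p, F 2 p * v p ∂phaseMeasure τ ≤ C * P * X := hterm (Equiv.refl _)
    have hpt : ∀ p, weight τ s 0 p *
        ((f 0 ⋆ₗ[phaseMeasure τ] f 2) ⋆ₗ[phaseMeasure τ] fun p => f 1 (-p)) p ≤
        d ^ 2 * (F 0 p + F 2 p + F 1 p) := fun p => by
      refine (weight_mul_trilinear_le (τ := τ) hs.le (hfm 0) (hfm 1) (hfm 2) p).trans_eq ?_
      simp only [F, wf, show (1 : Fin 3) ≠ 0 by decide, show (2 : Fin 3) ≠ 0 by decide,
        show (0 : Fin 3) ≠ 1 by decide, show (2 : Fin 3) ≠ 1 by decide,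
        show (0 : Fin 3) ≠ 2 by decide, show (1 : Fin 3) ≠ 2 by decide, if_true, if_false]
      rfl
    have m0 := hFm 0
    have m1 := hFm 1
    have m2 := hFm 2
    calc _ ≤ ∫⁻ p, (d : ℝ≥0∞) ^ 2 * (F 0 p * v p + F 2 p * v p + F 1 p * v p) ∂phaseMeasure τ := by
          refine lintegral_mono fun p => (mul_le_mul_left (hpt p) (v p)).trans_eq ?_
          ring
      _ = d ^ 2 * (∫⁻ p, F 0 p * v p ∂phaseMeasure τ + ∫⁻ p, F 2 p * v p ∂phaseMeasure τ +
            ∫⁻ p, F 1 p * v p ∂phaseMeasure τ) := by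
          rw [lintegral_const_mul _ (by fun_prop), lintegral_add_left (by fun_prop),
            lintegral_add_left (by fun_prop)]
      _ ≤ d ^ 2 * (C * P * X + C * P * X + C * P * X) := by gcongr
      _ = _ := by ring
  · rw [ENNReal.ofReal]
    push_cast
    ring

end Main

end DiscreteBourgain

end

/-! ### Assembly of the three claims -/

open DiscreteBourgain in
theorem theorem3p3 (s : ℝ) (hs : 0 < s) :
    (∀ b₁ : ℝ, 1 / 2 < b₁ →
      ∃ C : ℝ≥0, ∀ (τ : ℝ) [Fact (0 < τ)], τ ≤ 1 →
        ∀ u : ℤ → Torus → ℂ, MemX τ s b₁ u →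
          seqLpNorm τ 4 (fun n => filterProj τ (u n)) ≤ C * XNorm τ s b₁ u) ∧
    (∀ b : ℝ, max (1 / 4) (1 / 2 - s / 4) < b →
      ∃ C : ℝ≥0, ∀ (τ : ℝ) [Fact (0 < τ)], τ ≤ 1 →
        ∀ u₁ u₂ u₃ : ℤ → Torus → ℂ, MemX τ s b u₁ → MemX τ s b u₂ → MemX τ s b u₃ →
          MemX τ s (-b) (cubic τ u₁ u₂ u₃) ∧
          XNorm τ s (-b) (cubic τ u₁ u₂ u₃) ≤
            C * (XNorm τ s b u₁ * XNorm τ s b u₂ * XNorm τ s b u₃)) ∧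
    (∀ b : ℝ, max (1 / 4) (1 / 2 - s / 4) < b →
      ∃ C : ℝ≥0, ∀ (τ : ℝ) [Fact (0 < τ)], τ ≤ 1 →
        ∀ (ρ : Equiv.Perm (Fin 3)) (u : Fin 3 → ℤ → Torus → ℂ),
          MemX τ s b (u (ρ 0)) → MemX τ s b (u (ρ 1)) → MemX τ 0 b (u (ρ 2)) →
          MemX τ 0 (-b) (cubic τ (u 0) (u 1) (u 2)) ∧
          XNorm τ 0 (-b) (cubic τ (u 0) (u 1) (u 2)) ≤
            C * (XNorm τ s b (u (ρ 0)) * XNorm τ s b (u (ρ 1)) * XNorm τ 0 b (u (ρ 2)))) := by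
  have hb0 : ∀ b : ℝ, max (1 / 4) (1 / 2 - s / 4) < b → 0 ≤ b := fun b hb =>
    (by norm_num : (0 : ℝ) ≤ 1 / 4).trans ((le_max_left _ _).trans hb.le)
  refine ⟨fun b₁ hb₁ => ?_, fun b hb => ?_, fun b hb => ?_⟩
  · obtain ⟨C, hC⟩ := seqLpNorm_four_le hs hb₁
    exact ⟨C, fun τ _ _ u hu => hC τ u hu⟩
  · obtain ⟨C, hC⟩ := exists_xNorm_cubic_le hs hb
    refine ⟨C, fun τ _ _ u₁ u₂ u₃ h₁ h₂ h₃ => ?_⟩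
    obtain ⟨u, rfl, rfl, rfl⟩ : ∃ u : Fin 3 → ℤ → Torus → ℂ, u 0 = u₁ ∧ u 1 = u₂ ∧ u 2 = u₃ :=
      ⟨![u₁, u₂, u₃], rfl, rfl, rfl⟩
    have hu : ∀ i k, Memℓp (fun n => coeff (u i n) k) 2 := by
      intro i k
      rw [memℓp_two_iff]
      fin_cases i
      · exact h₁.summable k
      · exact h₂.summable k
      · exact h₃.summable k
    exact ⟨memX_cubic (hb0 b hb) hu, hC τ u hu⟩
  · obtain ⟨C, hC⟩ := exists_xNorm_cubic_le_of_perm hs hb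
    refine ⟨C, fun τ _ _ ρ u h₀ h₁ h₂ => ?_⟩
    have hρ : ∀ i k, Memℓp (fun n => coeff (u (ρ i) n) k) 2 := by
      intro i k
      rw [memℓp_two_iff]
      fin_cases i
      · exact h₀.summable k
      · exact h₁.summable k
      · exact h₂.summable k
    have hu : ∀ i k, Memℓp (fun n => coeff (u i n) k) 2 := fun i => by
      simpa using hρ (ρ.symm i)
    exact ⟨memX_cubic (hb0 b hb) hu, hC τ ρ u hu⟩
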